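/- Setting. Let $d\ge 1$, let $\mathcal X\subset\mathbb R^d$ be a closed convex set contained in the Euclidean ball of radius $R$ about the origin, let $x_0\in\mathcal X$, let $T\in\mathbb N$ and $\eta,\delta,D>0$. Directions $u_0,\dots,u_T$ are drawn successively; given the past $\mathcal F_t$ (a filtration for which $u_s$ is $\mathcal F_t$-measurable whenever $s<t$), $u_t$ is uniformly distributed on the unit sphere of $\mathbb R^d$ and independent of $\mathcal F_t$. The loss functions $f_0,\dots,f_T$ are fixed in advance or, more generally, $f_t$ is determined by $\mathcal F_t$. Each $f_t$ is convex on $\mathcal X$ and $L_t$-Lipschitz (with deterministic $L_t$) on the closed $\delta$-neighbourhood of $\mathcal X$, which contains all query points; put $L=\max_{0\le t\le T}L_t$. Write $w_t=x_t+\delta u_t$ and $$\tilde g^{(1)}_t=\frac{d\,u_t}{\delta}\bigl(f_t(w_t)-f_{t-1}(w_{t-1})\bigr),\qquad \tilde g^{(2)}_t=\frac{d\,u_t}{2\delta}\bigl(f_t(x_t+\delta u_t)-f_t(x_t-\delta u_t)\bigr),$$ $$D^a_t=\frac{|f_t(w_t)-f_{t-1}(w_{t-1})|}{\|w_t-w_{t-1}\|},\qquad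 D^b_t=\frac{|f_t(w_t)-f_{t-1}(w_{t-1})|}{\eta L}$$ (with $r/0=\infty$ for $r>0$ and $0/0=0$). For $\ast\in\{a,b\}$ the lazy method $\ast$ starts from $x_0$ with $\tilde g^\ast_0=\tilde g^{(2)}_0$, moves by $x_{t+1}=\Pi_{\mathcal X}(x_t-\eta\tilde g^\ast_t)$, where $\Pi_{\mathcal X}$ is the Euclidean projection, and for $t\ge1$ uses $\tilde g^\ast_t=\tilde g^{(1)}_t$ if $D^\ast_t\le D$ and $\tilde g^\ast_t=\tilde g^{(2)}_t$ otherwise; let $x^\ast_t$ denote its iterates. Claim. There is an absolute constant $c>0$ such that in every such setting $x^\ast_t$ is $\mathcal F_t$-measurable, $\|\tilde g^\ast_t\|^2$ is integrable for $0\le t\le T$, and almost surely $$\mathbb E\bigl[\|\tilde g^a_t\|^2\,\big|\,\mathcal F_t\bigr]\le c\,dL^2+\frac{2d^2D^2\eta^2}{\delta^2}\|\tilde g^a_{t-1}\|^2+8d^2D^2\qquad(1\le t\le T),$$ $$\mathbb E\bigl[\|\tilde g^b_t\|^2\,\big|\,\mathcal F_t\bigr]\le \frac{D^2\eta^2d^2L^2}{\delta^2}+c\,dL^2\qquad(0\le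 t\le T).$$ The same bounds hold when one conditions on the iterate $x^a_t$, respectively $x^b_t$, alone, with $\|\tilde g^a_{t-1}\|^2$ replaced by $\mathbb E[\|\tilde g^a_{t-1}\|^2\,|\,x^a_t]$ in the first one. Moreover, if $\eta=\frac{R}{L\sqrt{dT}}$ and $\delta=R\sqrt{d/T}$, then both conditional second moments given $\mathcal F_t$ are $O(d)$: for every $K$ and all $0\le t\le T$, if $D\le K L/\sqrt d$ and $D<L/\sqrt{10}$ then $\mathbb E[\|\tilde g^a_t\|^2|\mathcal F_t]\le (c+10K^2)\,dL^2$ almost surely, and if $D\le K\sqrt d\,L$ then $\mathbb E[\|\tilde g^b_t\|^2|\mathcal F_t]\le (c+K^2)\,dL^2$ almost surely. -/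

import Mathlib

open MeasureTheory ProbabilityTheory
open scoped NNReal ENNReal

/-- The uniform probability distribution `U(𝕊)` on the Euclidean unit sphere of `ℝ^d`:
the normalized surface measure. -/
noncomputable def uniformSphere (d : ℕ) :
    Measure (Metric.sphere (0 : EuclideanSpace ℝ (Fin d)) 1) :=
  ((volume : Measure (EuclideanSpace ℝ (Fin d))).toSphere Set.univ)⁻¹ •
    (volume : Measure (EuclideanSpace ℝ (Fin d))).toSphere

/-- Euclidean projection onto `X`: a point of `X` at minimal distance from `y`. It exists if `X` is
closed and non-empty, and is unique if `X` is moreover convex. -/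
noncomputable def euclideanProj {d : ℕ} (X : Set (EuclideanSpace ℝ (Fin d)))
    (y : EuclideanSpace ℝ (Fin d)) : EuclideanSpace ℝ (Fin d) :=
  Classical.epsilon fun p => p ∈ X ∧ ∀ z ∈ X, ‖y - p‖ ≤ ‖y - z‖

/-- One-point residual estimator `(d u / δ) (f(x + δ u) - f'(x' + δ u'))`, where `f'`, `x'`, `u'`
belong to the previous round. -/
noncomputable def residualEstimator {d : ℕ} (δ : ℝ) (f f' : EuclideanSpace ℝ (Fin d) → ℝ)
    (x u x' u' : EuclideanSpace ℝ (Fin d)) : EuclideanSpace ℝ (Fin d) :=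
  ((d : ℝ) / δ * (f (x + δ • u) - f' (x' + δ • u'))) • u

/-- Symmetric two-point estimator `(d u / (2 δ)) (f(x + δ u) - f(x - δ u))`. -/
noncomputable def twoPointEstimator {d : ℕ} (δ : ℝ) (f : EuclideanSpace ℝ (Fin d) → ℝ)
    (x u : EuclideanSpace ℝ (Fin d)) : EuclideanSpace ℝ (Fin d) :=
  ((d : ℝ) / (2 * δ) * (f (x + δ • u) - f (x - δ • u))) • u

/-- Temporal variation `D^a(x, y) = |f x - f' y| / ‖x - y‖`, with values in `[0, ∞]`, so that
`r / 0 = ∞` for `r > 0` and `0 / 0 = 0`. -/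
noncomputable def temporalVariationA {d : ℕ} (f f' : EuclideanSpace ℝ (Fin d) → ℝ)
    (x y : EuclideanSpace ℝ (Fin d)) : ℝ≥0∞ :=
  ENNReal.ofReal |f x - f' y| / ENNReal.ofReal ‖x - y‖

/-- Temporal variation `D^b(x, y) = |f x - f' y| / (η L)`, with values in `[0, ∞]`. -/
noncomputable def temporalVariationB {d : ℕ} (η L : ℝ) (f f' : EuclideanSpace ℝ (Fin d) → ℝ)
    (x y : EuclideanSpace ℝ (Fin d)) : ℝ≥0∞ :=
  ENNReal.ofReal |f x - f' y| / ENNReal.ofReal (η * L)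

open Classical in
/-- Lazy estimator with temporal variation `V` and threshold `D`: the one-point residual estimator
if `V (x + δ u, x' + δ u') ≤ D`, and the symmetric two-point estimator otherwise. -/
noncomputable def lazyEstimator {d : ℕ}
    (V : (EuclideanSpace ℝ (Fin d) → ℝ) → (EuclideanSpace ℝ (Fin d) → ℝ) →
      EuclideanSpace ℝ (Fin d) → EuclideanSpace ℝ (Fin d) → ℝ≥0∞)
    (δ D : ℝ) (f f' : EuclideanSpace ℝ (Fin d) → ℝ)
    (x u x' u' : EuclideanSpace ℝ (Fin d)) : EuclideanSpace ℝ (Fin d) :=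
  if V f f' (x + δ • u) (x' + δ • u') ≤ ENNReal.ofReal D then
    residualEstimator δ f f' x u x' u'
  else twoPointEstimator δ f x u

/-- The lazy zeroth-order method with temporal variation `V`, run on the losses `f 0, f 1, …` and
the directions `u 0, u 1, …`. The value at `t` is the pair of the iterate `x_t` and the gradient
estimate `g_t`; the first estimate is the two-point one, and `x_{t+1} = Π_X (x_t - η g_t)`. -/
noncomputable def lazoRun {d : ℕ}
    (V : (EuclideanSpace ℝ (Fin d) → ℝ) → (EuclideanSpace ℝ (Fin d) → ℝ) →
      EuclideanSpace ℝ (Fin d) → EuclideanSpace ℝ (Fin d) → ℝ≥0∞)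
    (X : Set (EuclideanSpace ℝ (Fin d))) (x₀ : EuclideanSpace ℝ (Fin d)) (η δ D : ℝ)
    (f : ℕ → EuclideanSpace ℝ (Fin d) → ℝ) (u : ℕ → EuclideanSpace ℝ (Fin d)) :
    ℕ → EuclideanSpace ℝ (Fin d) × EuclideanSpace ℝ (Fin d)
  | 0 => (x₀, twoPointEstimator δ (f 0) x₀ (u 0))
  | t + 1 =>
    let p := lazoRun V X x₀ η δ D f u t
    let x := euclideanProj X (p.1 - η • p.2)
    (x, lazyEstimator V δ D (f (t + 1)) (f t) x (u (t + 1)) p.1 (u t))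

/-!
An odd function is reversed by the half-turn. Carry a pair of independent standard Gaussian vectors
through the half-turn in `N` equal rotations: the pair stays Gaussian, so the `N` increments of an
odd `F` are identically distributed, and letting `N → ∞` gives `4 E F² ≤ π² E ⟨∇F(x), y⟩² ≤ π² K²`
for every odd `K`-Lipschitz `F`, whatever the dimension. Extending an odd function on the sphere
homogeneously of degree one and passing to polar coordinates turns this into a variance bound of
order `K² / d` on the sphere. Hence the two-point estimator, which is `d / (2 δ)` times an odd
function of the direction with Lipschitz constant `2 δ L`, has second moment of order `d L²`.
In every round the lazy estimator either is this two-point estimator or is small because the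
temporal variation stays below the threshold.
-/

open Filter Topology

section Rotation

theorem integral_sq_comp_iterate_sub_le {α : Type*} {mα : MeasurableSpace α} {μ : Measure α}
    {R : α → α} (hR : MeasurePreserving R μ μ) {G : α → ℝ} (hG : MemLp G 2 μ) (N : ℕ) :
    ∫ a, (G (R^[N] a) - G a) ^ 2 ∂μ ≤ ∫ a, (N * (G (R a) - G a)) ^ 2 ∂μ := by
  set Δ : α → ℝ := fun a => G (R a) - G a with hΔ
  have hΔ_sq : Integrable (fun a => Δ a ^ 2) μ :=
    ((hG.comp_measurePreserving hR).sub hG).integrable_sq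
  have hint (k : ℕ) : Integrable (fun a => Δ (R^[k] a) ^ 2) μ :=
    (hR.iterate k).integrable_comp_of_integrable hΔ_sq
  have hstationary (k : ℕ) : ∫ a, Δ (R^[k] a) ^ 2 ∂μ = ∫ a, Δ a ^ 2 ∂μ := by
    have h := integral_map (hR.iterate k).aemeasurable (f := fun a => Δ a ^ 2)
      (by rw [(hR.iterate k).map_eq]; exact hΔ_sq.aestronglyMeasurable)
    rw [(hR.iterate k).map_eq] at h
    exact h.symm
  have htelescope (a : α) :
      (G (R^[N] a) - G a) ^ 2 ≤ N * ∑ k ∈ Finset.range N, Δ (R^[k] a) ^ 2 := by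
    have h := Finset.sum_range_sub (fun k => G (R^[k] a)) N
    simp only [Function.iterate_succ_apply', Function.iterate_zero, id_eq] at h
    rw [← h]
    simpa only [Finset.card_range] using
      sq_sum_le_card_mul_sum_sq (s := Finset.range N) (f := fun k => Δ (R^[k] a))
  calc ∫ a, (G (R^[N] a) - G a) ^ 2 ∂μ
      ≤ ∫ a, N * ∑ k ∈ Finset.range N, Δ (R^[k] a) ^ 2 ∂μ :=
        integral_mono_of_nonneg (.of_forall fun _ => sq_nonneg _)
          ((integrable_finsetSum _ fun k _ => hint k).const_mul _) (.of_forall htelescope)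
    _ = N ^ 2 * ∫ a, Δ a ^ 2 ∂μ := by
        rw [integral_const_mul, integral_finsetSum _ fun k _ => hint k]
        simp only [hstationary, Finset.sum_const, Finset.card_range, nsmul_eq_mul]
        ring
    _ = ∫ a, (N * (G (R a) - G a)) ^ 2 ∂μ := by simp only [mul_pow, integral_const_mul, hΔ]

variable {E : Type*} [NormedAddCommGroup E] [NormedSpace ℝ E]

theorem iterate_rotation (θ : ℝ) (k : ℕ) :
    (ContinuousLinearMap.rotation θ : E × E →L[ℝ] E × E)^[k] =
      ContinuousLinearMap.rotation (k * θ) := by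
  induction k with
  | zero => ext p <;> simp [ContinuousLinearMap.rotation_apply]
  | succ k ih =>
    ext p <;>
    · rw [Function.iterate_succ_apply', ih]
      simp only [ContinuousLinearMap.rotation_apply, Nat.cast_add_one, add_mul, one_mul,
        Real.cos_add, Real.sin_add]
      module

theorem norm_rotation_fst_sub_le (θ : ℝ) (p : E × E) :
    ‖(ContinuousLinearMap.rotation θ p).1 - p.1‖ ≤ |θ| * (‖p.1‖ + ‖p.2‖) := by
  have hcos : |Real.cos θ - 1| ≤ |θ| := by simpa using Real.abs_cos_sub_cos_le (x := θ) (y := 0)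
  calc ‖(ContinuousLinearMap.rotation θ p).1 - p.1‖
      = ‖(Real.cos θ - 1) • p.1 + Real.sin θ • p.2‖ := by
        rw [ContinuousLinearMap.rotation_apply]; congr 1; module
    _ ≤ |Real.cos θ - 1| * ‖p.1‖ + |Real.sin θ| * ‖p.2‖ := by
        simpa only [norm_smul, Real.norm_eq_abs] using
          norm_add_le ((Real.cos θ - 1) • p.1) (Real.sin θ • p.2)
    _ ≤ |θ| * (‖p.1‖ + ‖p.2‖) := by
        rw [mul_add]
        gcongr ?_ * ‖p.1‖ + ?_ * ‖p.2‖
        exact Real.abs_sin_le_abs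

theorem hasDerivAt_rotation_fst (p : E × E) :
    HasDerivAt (fun θ => (ContinuousLinearMap.rotation θ p).1) p.2 0 := by
  simpa [ContinuousLinearMap.rotation_apply] using
    ((Real.hasDerivAt_cos 0).smul_const p.1).fun_add ((Real.hasDerivAt_sin 0).smul_const p.2)

theorem tendsto_mul_rotation_fst_sub {F : E → ℝ} {p : E × E} (hF : DifferentiableAt ℝ F p.1)
    (a : ℝ) :
    Tendsto (fun N : ℕ => N * (F (ContinuousLinearMap.rotation (a / N) p).1 - F p.1)) atTop
      (𝓝 (a * fderiv ℝ F p.1 p.2)) := by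
  have hderiv : HasDerivAt (fun θ => F (ContinuousLinearMap.rotation θ p).1)
      (fderiv ℝ F p.1 p.2) 0 := by
    refine HasFDerivAt.comp_hasDerivAt 0 ?_ (hasDerivAt_rotation_fst p)
    simpa [ContinuousLinearMap.rotation_apply] using hF.hasFDerivAt
  simpa [ContinuousLinearMap.rotation_apply, div_eq_inv_mul, Function.comp_def] using
    (hderiv.hasFDerivAt.lim_real a).comp tendsto_natCast_atTop_atTop

end Rotation

section Gaussian

variable {E : Type*} [NormedAddCommGroup E] [InnerProductSpace ℝ E] [FiniteDimensional ℝ E]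
  [MeasurableSpace E] [BorelSpace E]

theorem integrable_exp_neg_half_mul_sq_norm :
    Integrable fun x : E => Real.exp (-(1 / 2) * ‖x‖ ^ 2) := by
  have h := GaussianFourier.integrable_cexp_neg_mul_sq_norm_add (V := E) (b := (1 / 2 : ℂ))
    (by norm_num) 0 0
  refine h.norm.congr (.of_forall fun x => ?_)
  simp only [Complex.norm_exp]
  norm_cast
  simp
  norm_cast

theorem stdGaussian_eq_tilted :
    stdGaussian E = volume.tilted fun x => -(1 / 2) * ‖x‖ ^ 2 := by
  have := isProbabilityMeasure_tilted (integrable_exp_neg_half_mul_sq_norm (E := E))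
  refine Measure.ext_of_charFun (funext fun t => ?_)
  have hdensity (x : E) : (Real.exp (-(1 / 2) * ‖x‖ ^ 2) / ∫ y : E, Real.exp (-(1 / 2) * ‖y‖ ^ 2)) •
      Complex.exp (inner ℝ x t * Complex.I) = (∫ y : E, Real.exp (-(1 / 2) * ‖y‖ ^ 2) : ℝ)⁻¹ *
      Complex.exp (-(1 / 2 : ℂ) * ‖x‖ ^ 2 + Complex.I * inner ℝ t x) := by
    rw [Complex.exp_add, real_inner_comm, Complex.real_smul]
    push_cast
    ring_nf
  rw [charFun_stdGaussian, charFun_apply, integral_tilted]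
  simp_rw [hdensity]
  rw [integral_const_mul, GaussianFourier.integral_cexp_neg_mul_sq_norm_add (by norm_num),
    GaussianFourier.integral_rexp_neg_mul_sq_norm (by norm_num)]
  have hnormalization : (((Real.pi / (1 / 2)) ^ (Module.finrank ℝ E / 2 : ℝ) : ℝ) : ℂ) =
      (Real.pi / (1 / 2)) ^ (Module.finrank ℝ E / 2 : ℂ) := by
    rw [Complex.ofReal_cpow (by positivity)]
    push_cast
    rfl
  rw [Complex.ofReal_inv, hnormalization, inv_mul_cancel_left₀ (by
    rw [← hnormalization]; exact_mod_cast (by positivity)), Complex.I_sq]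
  ring_nf

theorem stdGaussian_absolutelyContinuous : stdGaussian E ≪ (volume : Measure E) := by
  rw [stdGaussian_eq_tilted]
  exact tilted_absolutelyContinuous _ _

theorem integral_sq_strongDual_stdGaussian (l : StrongDual ℝ E) :
    ∫ x, l x ^ 2 ∂(stdGaussian E) = ‖l‖ ^ 2 := by
  rw [← variance_dual_stdGaussian,
    variance_of_integral_eq_zero l.continuous.aemeasurable (integral_strongDual_stdGaussian l)]

theorem integrable_sq_norm_stdGaussian : Integrable (fun x : E => ‖x‖ ^ 2) (stdGaussian E) :=
  IsGaussian.memLp_two_id.integrable_norm_pow (by norm_num)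

theorem integral_sq_norm_stdGaussian :
    ∫ x, ‖x‖ ^ 2 ∂(stdGaussian E) = Module.finrank ℝ E := by
  set b := stdOrthonormalBasis ℝ E
  calc ∫ x, ‖x‖ ^ 2 ∂(stdGaussian E)
      = ∫ x, ∑ i, innerSL ℝ (b i) x ^ 2 ∂(stdGaussian E) := by
        simp only [innerSL_apply_apply, b.sum_sq_inner_right]
    _ = ∑ i, ‖innerSL ℝ (b i)‖ ^ 2 := by
        rw [integral_finsetSum _ fun i _ => (IsGaussian.memLp_dual (stdGaussian E)
          (innerSL ℝ (b i)) 2 (by simp)).integrable_sq]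
        simp only [integral_sq_strongDual_stdGaussian]
    _ = Module.finrank ℝ E := by simp

theorem integrable_sq_add_norm_stdGaussian_prod :
    Integrable (fun p : E × E => (‖p.1‖ + ‖p.2‖) ^ 2) ((stdGaussian E).prod (stdGaussian E)) := by
  have h := IsGaussian.memLp_two_id (μ := stdGaussian E)
  exact ((h.norm.comp_fst (stdGaussian E)).add (h.norm.comp_snd (stdGaussian E))).integrable_sq

theorem ae_differentiableAt_stdGaussian {F : E → ℝ} {K : ℝ≥0} (hF : LipschitzWith K F) :
    ∀ᵐ x ∂(stdGaussian E), DifferentiableAt ℝ F x :=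
  stdGaussian_absolutelyContinuous.ae_le hF.ae_differentiableAt

theorem tendsto_integral_sq_mul_rotation_fst_sub {F : E → ℝ} {K : ℝ≥0} (hF : LipschitzWith K F)
    (a : ℝ) :
    Tendsto (fun N : ℕ => ∫ p, (N * (F (ContinuousLinearMap.rotation (a / N) p).1 - F p.1)) ^ 2
        ∂((stdGaussian E).prod (stdGaussian E))) atTop
      (𝓝 (∫ p, (a * fderiv ℝ F p.1 p.2) ^ 2 ∂((stdGaussian E).prod (stdGaussian E)))) := by
  have hbound (N : ℕ) (p : E × E) :
      |N * (F (ContinuousLinearMap.rotation (a / N) p).1 - F p.1)| ≤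
        K * |a| * (‖p.1‖ + ‖p.2‖) := by
    rcases N.eq_zero_or_pos with rfl | hN
    · simp only [CharP.cast_eq_zero, zero_mul, abs_zero]
      positivity
    calc |N * (F (ContinuousLinearMap.rotation (a / N) p).1 - F p.1)|
        = N * |F (ContinuousLinearMap.rotation (a / N) p).1 - F p.1| := by
          rw [abs_mul, Nat.abs_cast]
      _ ≤ N * (K * (|a / N| * (‖p.1‖ + ‖p.2‖))) := by
          gcongr
          exact (hF.norm_sub_le _ _).trans (by gcongr; exact norm_rotation_fst_sub_le _ p)
      _ = K * |a| * (‖p.1‖ + ‖p.2‖) := by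
          rw [abs_div, Nat.abs_cast]
          field_simp
  have hcont := hF.continuous
  refine tendsto_integral_of_dominated_convergence
    (fun p => (K * |a|) ^ 2 * (‖p.1‖ + ‖p.2‖) ^ 2) (fun N => by fun_prop)
    (integrable_sq_add_norm_stdGaussian_prod.const_mul _) (fun N => .of_forall fun p => ?_) ?_
  · rw [Real.norm_eq_abs, abs_pow, ← mul_pow]
    gcongr
    exact hbound N p
  · filter_upwards [Measure.quasiMeasurePreserving_fst.ae (ae_differentiableAt_stdGaussian hF)]
      with p hp
    exact (tendsto_mul_rotation_fst_sub hp a).pow 2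

theorem integral_sq_fderiv_stdGaussian_prod_le {F : E → ℝ} {K : ℝ≥0} (hF : LipschitzWith K F) :
    ∫ p, fderiv ℝ F p.1 p.2 ^ 2 ∂((stdGaussian E).prod (stdGaussian E)) ≤ (K : ℝ) ^ 2 := by
  have hnorm (x : E) : ‖fderiv ℝ F x‖ ≤ K := norm_fderiv_le_of_lipschitz ℝ hF
  have hmeas : Measurable fun p : E × E => fderiv ℝ F p.1 p.2 :=
    isBoundedBilinearMap_apply.continuous.measurable.comp
      (((measurable_fderiv ℝ F).comp measurable_fst).prodMk measurable_snd)
  have hint : Integrable (fun p : E × E => fderiv ℝ F p.1 p.2 ^ 2)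
      ((stdGaussian E).prod (stdGaussian E)) := by
    refine ((integrable_sq_norm_stdGaussian.comp_snd _).const_mul ((K : ℝ) ^ 2)).mono'
      (hmeas.pow_const 2).aestronglyMeasurable (.of_forall fun p => ?_)
    rw [norm_pow, ← mul_pow]
    gcongr
    exact (fderiv ℝ F p.1).le_of_opNorm_le (hnorm _) _
  calc ∫ p, fderiv ℝ F p.1 p.2 ^ 2 ∂((stdGaussian E).prod (stdGaussian E))
      = ∫ x, ‖fderiv ℝ F x‖ ^ 2 ∂(stdGaussian E) := by
        rw [integral_prod _ hint]
        simp only [integral_sq_strongDual_stdGaussian]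
    _ ≤ ∫ _ : E, (K : ℝ) ^ 2 ∂(stdGaussian E) := by
        refine integral_mono_of_nonneg (.of_forall fun _ => sq_nonneg _) (integrable_const _)
          (.of_forall fun x => ?_)
        beta_reduce
        gcongr
        exact hnorm x
    _ = (K : ℝ) ^ 2 := by simp

theorem integral_sq_stdGaussian_le_of_odd {F : E → ℝ} {K : ℝ≥0} (hF : LipschitzWith K F)
    (hodd : F.Odd) :
    ∫ x, F x ^ 2 ∂(stdGaussian E) ≤ Real.pi ^ 2 / 4 * (K : ℝ) ^ 2 := by
  have hrot (θ : ℝ) : MeasurePreserving (ContinuousLinearMap.rotation θ : E × E →L[ℝ] E × E)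
      ((stdGaussian E).prod (stdGaussian E)) ((stdGaussian E).prod (stdGaussian E)) :=
    ⟨by fun_prop, IsGaussian.map_rotation_eq_self (by simp) θ⟩
  have hmemLp : MemLp (fun p : E × E => F p.1) 2 ((stdGaussian E).prod (stdGaussian E)) :=
    (hF.comp_memLp hodd.map_zero IsGaussian.memLp_two_id).comp_fst _
  have hhalf_turn (p : E × E) :
      (F (ContinuousLinearMap.rotation Real.pi p).1 - F p.1) ^ 2 = 4 * F p.1 ^ 2 := by
    have : (ContinuousLinearMap.rotation Real.pi p).1 = -p.1 := by
      simp [ContinuousLinearMap.rotation_apply]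
    rw [this, hodd]
    ring
  have hincrement (N : ℕ) (hN : 1 ≤ N) : 4 * ∫ x, F x ^ 2 ∂(stdGaussian E) ≤
      ∫ p, (N * (F (ContinuousLinearMap.rotation (Real.pi / N) p).1 - F p.1)) ^ 2
        ∂((stdGaussian E).prod (stdGaussian E)) := by
    have h := integral_sq_comp_iterate_sub_le (hrot (Real.pi / N)) hmemLp N
    simp only [iterate_rotation, mul_div_cancel₀ Real.pi (by positivity : (N : ℝ) ≠ 0),
      hhalf_turn, integral_const_mul] at h
    simpa only [integral_fun_fst fun x => F x ^ 2, probReal_univ, one_smul] using h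
  have hlimit : 4 * ∫ x, F x ^ 2 ∂(stdGaussian E) ≤ Real.pi ^ 2 *
      ∫ p, fderiv ℝ F p.1 p.2 ^ 2 ∂((stdGaussian E).prod (stdGaussian E)) := by
    simpa only [mul_pow, integral_const_mul] using
      ge_of_tendsto (tendsto_integral_sq_mul_rotation_fst_sub hF Real.pi)
        (eventually_atTop.2 ⟨1, hincrement⟩)
  have hgradient := mul_le_mul_of_nonneg_left (integral_sq_fderiv_stdGaussian_prod_le hF)
    (sq_nonneg Real.pi)
  linarith

end Gaussian

section Sphere

theorem norm_normalize_le_one {E : Type*} [NormedAddCommGroup E] [NormedSpace ℝ E] (x : E) :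
    ‖NormedSpace.normalize x‖ ≤ 1 := by
  rcases eq_or_ne x 0 with rfl | hx
  · simp
  · exact (NormedSpace.norm_normalize hx).le

theorem norm_mul_norm_normalize_sub_normalize_le {E : Type*} [NormedAddCommGroup E]
    [NormedSpace ℝ E] (x y : E) :
    ‖y‖ * ‖NormedSpace.normalize x - NormedSpace.normalize y‖ ≤ 2 * ‖x - y‖ := by
  calc ‖y‖ * ‖NormedSpace.normalize x - NormedSpace.normalize y‖
      = ‖‖y‖ • NormedSpace.normalize x - y‖ := by
        conv_rhs => enter [1, 2]; rw [← NormedSpace.norm_smul_normalize y]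
        rw [← smul_sub, norm_smul, norm_norm]
    _ = ‖(x - y) + (‖y‖ - ‖x‖) • NormedSpace.normalize x‖ := by
        rw [sub_smul, NormedSpace.norm_smul_normalize]
        congr 1
        abel
    _ ≤ ‖x - y‖ + |‖y‖ - ‖x‖| * ‖NormedSpace.normalize x‖ := by
        rw [← Real.norm_eq_abs, ← norm_smul]
        exact norm_add_le _ _
    _ ≤ ‖x - y‖ + ‖x - y‖ * 1 := by
        gcongr
        · rw [norm_sub_rev]
          exact abs_norm_sub_norm_le y x
        · exact norm_normalize_le_one x
    _ = 2 * ‖x - y‖ := by ring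

theorem lipschitzWith_norm_mul_comp_normalize {E : Type*} [NormedAddCommGroup E]
    [NormedSpace ℝ E] {h : E → ℝ} {K : ℝ≥0} (hh : LipschitzWith K h) (h0 : h 0 = 0) :
    LipschitzWith (3 * K) fun x => ‖x‖ * h (NormedSpace.normalize x) := by
  refine LipschitzWith.of_dist_le_mul fun x y => ?_
  set v := NormedSpace.normalize x
  set w := NormedSpace.normalize y
  have hv : |h v| ≤ K :=
    calc |h v| ≤ K * ‖v‖ := by simpa [h0] using hh.norm_sub_le v 0
      _ ≤ K := mul_le_of_le_one_right K.2 (norm_normalize_le_one x)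
  rw [Real.dist_eq, dist_eq_norm]
  push_cast
  calc |‖x‖ * h v - ‖y‖ * h w| = |(‖x‖ - ‖y‖) * h v + ‖y‖ * (h v - h w)| := by
        congr 1; ring
    _ ≤ |‖x‖ - ‖y‖| * |h v| + ‖y‖ * |h v - h w| := by
        simpa only [abs_mul, abs_norm] using abs_add_le ((‖x‖ - ‖y‖) * h v) (‖y‖ * (h v - h w))
    _ ≤ ‖x - y‖ * K + ‖y‖ * (K * ‖v - w‖) := by
        gcongr
        · exact abs_norm_sub_norm_le x y
        · exact hh.norm_sub_le v w
    _ = ‖x - y‖ * K + K * (‖y‖ * ‖v - w‖) := by ring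
    _ ≤ ‖x - y‖ * K + K * (2 * ‖x - y‖) := by
        gcongr ‖x - y‖ * K + K * ?_
        exact norm_mul_norm_normalize_sub_normalize_le x y
    _ = 3 * K * ‖x - y‖ := by ring

theorem exists_odd_lipschitzWith_eqOn {E : Type*} [SeminormedAddCommGroup E] {s : Set E}
    {h : E → ℝ} {K : ℝ≥0} (hh : LipschitzOnWith K h s) (hs : ∀ v ∈ s, -v ∈ s)
    (hodd : ∀ v ∈ s, h (-v) = -h v) :
    ∃ h' : E → ℝ, LipschitzWith K h' ∧ h'.Odd ∧ Set.EqOn h h' s := by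
  obtain ⟨h', hh', heq⟩ := hh.extend_real
  refine ⟨fun v => (h' v - h' (-v)) / 2, LipschitzWith.of_dist_le_mul fun v w => ?_, fun v => ?_,
    fun v hv => ?_⟩
  · have h₁ := hh'.norm_sub_le v w
    have h₂ := hh'.norm_sub_le (-w) (-v)
    rw [neg_sub_neg] at h₂
    rw [Real.norm_eq_abs, abs_le] at h₁ h₂
    rw [Real.dist_eq, dist_eq_norm, abs_le]
    constructor <;> linarith
  · simp only [neg_neg]
    ring
  · beta_reduce
    rw [← heq hv, ← heq (hs v hv), hodd v hv]
    ring

theorem lintegral_norm_mul_normalize {E : Type*} [NormedAddCommGroup E] [NormedSpace ℝ E]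
    [FiniteDimensional ℝ E] [Nontrivial E] [MeasurableSpace E] [BorelSpace E] (μ : Measure E)
    [μ.IsAddHaarMeasure] {g : ℝ → ℝ≥0∞} (hg : Measurable g) {H : E → ℝ≥0∞} (hH : Measurable H) :
    ∫⁻ x, g ‖x‖ * H (NormedSpace.normalize x) ∂μ =
      (∫⁻ s, H s.1 ∂μ.toSphere) *
        ∫⁻ r, g r.1 ∂(Measure.volumeIoiPow (Module.finrank ℝ E - 1)) := by
  have hpolar := μ.measurePreserving_homeomorphUnitSphereProd
  calc ∫⁻ x, g ‖x‖ * H (NormedSpace.normalize x) ∂μ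
      = ∫⁻ x in ({0}ᶜ : Set E), g ‖x‖ * H (‖x‖⁻¹ • x) ∂μ := by
        rw [restrict_compl_singleton]
        rfl
    _ = ∫⁻ x : ({0}ᶜ : Set E), g ‖x.1‖ * H (‖x.1‖⁻¹ • x.1) ∂(μ.comap Subtype.val) := by
        rw [lintegral_subtype_comap (measurableSet_singleton (0 : E)).compl
          (fun x => g ‖x‖ * H (‖x‖⁻¹ • x))]
    _ = ∫⁻ p, H p.1.1 * g p.2.1
          ∂(μ.toSphere.prod (Measure.volumeIoiPow (Module.finrank ℝ E - 1))) := by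
        rw [← hpolar.lintegral_comp (by fun_prop)]
        simp [mul_comm]
    _ = _ := lintegral_prod_mul (f := fun s : Metric.sphere (0 : E) 1 => H s.1)
        (g := fun r : Set.Ioi (0 : ℝ) => g r.1) (by fun_prop) (by fun_prop)

theorem toSphere_univ_ne_zero {d : ℕ} (hd : d ≠ 0) :
    (volume : Measure (EuclideanSpace ℝ (Fin d))).toSphere Set.univ ≠ 0 :=
  have : NeZero d := ⟨hd⟩
  Measure.measure_univ_ne_zero.2 (Measure.toSphere_ne_zero _)

theorem toSphere_eq_smul_uniformSphere {d : ℕ} (hd : d ≠ 0) :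
    (volume : Measure (EuclideanSpace ℝ (Fin d))).toSphere =
      (volume : Measure (EuclideanSpace ℝ (Fin d))).toSphere Set.univ • uniformSphere d := by
  rw [uniformSphere, smul_smul, ENNReal.mul_inv_cancel (toSphere_univ_ne_zero hd)
    (measure_ne_top _ _), one_smul]

theorem lintegral_norm_mul_normalize_stdGaussian {d : ℕ} (hd : d ≠ 0) {g : ℝ → ℝ≥0∞}
    (hg : Measurable g) {H : EuclideanSpace ℝ (Fin d) → ℝ≥0∞} (hH : Measurable H) :
    ∫⁻ x, g ‖x‖ * H (NormedSpace.normalize x) ∂(stdGaussian (EuclideanSpace ℝ (Fin d))) =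
      (∫⁻ x, g ‖x‖ ∂(stdGaussian (EuclideanSpace ℝ (Fin d)))) *
        ∫⁻ s, H s.1 ∂(uniformSphere d) := by
  have : NeZero d := ⟨hd⟩
  let ρ (r : ℝ) : ℝ≥0∞ := ENNReal.ofReal
    (Real.exp (-(1 / 2) * r ^ 2) / ∫ y : EuclideanSpace ℝ (Fin d), Real.exp (-(1 / 2) * ‖y‖ ^ 2))
  have hpolar {G : EuclideanSpace ℝ (Fin d) → ℝ≥0∞} (hG : Measurable G) :=
    lintegral_norm_mul_normalize (volume : Measure (EuclideanSpace ℝ (Fin d)))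
      (g := fun r => ρ r * g r) (by fun_prop) hG
  have hradial := hpolar (G := fun _ => 1) measurable_const
  simp only [mul_one, lintegral_const, one_mul] at hradial
  simp only [stdGaussian_eq_tilted, lintegral_tilted, ← mul_assoc]
  have hdirection := congrArg (fun μ => ∫⁻ s, H s.1 ∂μ) (toSphere_eq_smul_uniformSphere hd)
  rw [hpolar hH, hradial, hdirection, lintegral_smul_measure, smul_eq_mul]
  ring

theorem lintegral_sq_norm_stdGaussian {E : Type*} [NormedAddCommGroup E] [InnerProductSpace ℝ E]
    [FiniteDimensional ℝ E] [MeasurableSpace E] [BorelSpace E] :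
    ∫⁻ x, ENNReal.ofReal (‖x‖ ^ 2) ∂(stdGaussian E) = Module.finrank ℝ E := by
  rw [← ofReal_integral_eq_lintegral_ofReal integrable_sq_norm_stdGaussian
    (.of_forall fun _ => sq_nonneg _), integral_sq_norm_stdGaussian, ENNReal.ofReal_natCast]

theorem integral_sq_norm_mul_normalize_stdGaussian {d : ℕ} (hd : d ≠ 0)
    {h : EuclideanSpace ℝ (Fin d) → ℝ} (hh : Measurable h) :
    ∫ x, (‖x‖ * h (NormedSpace.normalize x)) ^ 2 ∂(stdGaussian (EuclideanSpace ℝ (Fin d))) =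
      d * ∫ s, h s.1 ^ 2 ∂(uniformSphere d) := by
  have hmeas : Measurable fun s : Metric.sphere (0 : EuclideanSpace ℝ (Fin d)) 1 => h s.1 :=
    hh.comp measurable_subtype_coe
  rw [integral_eq_lintegral_of_nonneg_ae (.of_forall fun _ => sq_nonneg _) (by
      unfold NormedSpace.normalize; fun_prop),
    integral_eq_lintegral_of_nonneg_ae (.of_forall fun _ => sq_nonneg _)
      (hmeas.pow_const 2).aestronglyMeasurable]
  simp only [mul_pow, ENNReal.ofReal_mul (sq_nonneg _)]
  rw [lintegral_norm_mul_normalize_stdGaussian hd (g := fun r => ENNReal.ofReal (r ^ 2))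
    (H := fun v => ENNReal.ofReal (h v ^ 2)) (by fun_prop) (by fun_prop),
    lintegral_sq_norm_stdGaussian, finrank_euclideanSpace_fin, ENNReal.toReal_mul,
    ENNReal.toReal_natCast]

theorem integral_sq_uniformSphere_le_of_odd {d : ℕ} {h : EuclideanSpace ℝ (Fin d) → ℝ} {K : ℝ≥0}
    (hd : d ≠ 0) (hh : LipschitzOnWith K h (Metric.sphere 0 1))
    (hodd : ∀ v ∈ Metric.sphere (0 : EuclideanSpace ℝ (Fin d)) 1, h (-v) = -h v) :
    ∫ s, h s.1 ^ 2 ∂(uniformSphere d) ≤ 23 * (K : ℝ) ^ 2 / d := by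
  obtain ⟨h', hh', hodd', heq⟩ := exists_odd_lipschitzWith_eqOn hh (by simp) hodd
  have hodd_extension : Function.Odd fun x : EuclideanSpace ℝ (Fin d) =>
      ‖x‖ * h' (NormedSpace.normalize x) := fun x => by
    simp only [norm_neg, NormedSpace.normalize_neg, hodd' _, mul_neg]
  have hgauss := integral_sq_stdGaussian_le_of_odd
    (lipschitzWith_norm_mul_comp_normalize hh' hodd'.map_zero) hodd_extension
  rw [integral_sq_norm_mul_normalize_stdGaussian hd hh'.continuous.measurable] at hgauss
  have hpi : Real.pi ^ 2 ≤ 10 := by nlinarith [Real.pi_gt_three, Real.pi_lt_d2]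
  have hd' : (0 : ℝ) < d := by positivity
  simp only [fun s : Metric.sphere (0 : EuclideanSpace ℝ (Fin d)) 1 => heq s.2]
  rw [le_div_iff₀' hd']
  calc d * ∫ s, h' s.1 ^ 2 ∂(uniformSphere d) ≤ Real.pi ^ 2 / 4 * (3 * K) ^ 2 := by
        exact_mod_cast hgauss
    _ ≤ 10 / 4 * (3 * K) ^ 2 := by gcongr
    _ ≤ 23 * (K : ℝ) ^ 2 := by nlinarith [sq_nonneg (K : ℝ)]

end Sphere

section Projection

variable {d : ℕ} {X : Set (EuclideanSpace ℝ (Fin d))}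

theorem euclideanProj_mem_and_norm_sub_le (hclosed : IsClosed X) (hne : X.Nonempty)
    (y : EuclideanSpace ℝ (Fin d)) :
    euclideanProj X y ∈ X ∧ ∀ z ∈ X, ‖y - euclideanProj X y‖ ≤ ‖y - z‖ := by
  obtain ⟨p, hp, hdist⟩ := hclosed.exists_infDist_eq_dist hne y
  refine Classical.epsilon_spec (p := fun p => p ∈ X ∧ ∀ z ∈ X, ‖y - p‖ ≤ ‖y - z‖)
    ⟨p, hp, fun z hz => ?_⟩
  rw [← dist_eq_norm, ← dist_eq_norm, ← hdist]
  exact Metric.infDist_le_dist_of_mem hz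

theorem euclideanProj_mem (hclosed : IsClosed X) (hne : X.Nonempty)
    (y : EuclideanSpace ℝ (Fin d)) : euclideanProj X y ∈ X :=
  (euclideanProj_mem_and_norm_sub_le hclosed hne y).1

theorem euclideanProj_of_mem (hclosed : IsClosed X) {x : EuclideanSpace ℝ (Fin d)} (hx : x ∈ X) :
    euclideanProj X x = x := by
  have h := (euclideanProj_mem_and_norm_sub_le hclosed ⟨x, hx⟩ x).2 x hx
  rw [sub_self, norm_zero, norm_le_zero_iff, sub_eq_zero] at h
  exact h.symm

theorem inner_sub_euclideanProj_nonpos (hconvex : Convex ℝ X) (hclosed : IsClosed X)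
    (y : EuclideanSpace ℝ (Fin d)) {z : EuclideanSpace ℝ (Fin d)} (hz : z ∈ X) :
    inner ℝ (y - euclideanProj X y) (z - euclideanProj X y) ≤ 0 := by
  obtain ⟨hmem, hmin⟩ := euclideanProj_mem_and_norm_sub_le hclosed ⟨z, hz⟩ y
  have : Nonempty X := ⟨⟨z, hz⟩⟩
  refine (norm_eq_iInf_iff_real_inner_le_zero hconvex hmem).1 (le_antisymm ?_ ?_) z hz
  · exact le_ciInf fun w => hmin w w.2
  · exact ciInf_le ⟨0, by rintro _ ⟨w, rfl⟩; exact norm_nonneg _⟩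
      (⟨euclideanProj X y, hmem⟩ : X)

theorem lipschitzWith_euclideanProj (hconvex : Convex ℝ X) (hclosed : IsClosed X)
    (hne : X.Nonempty) : LipschitzWith 1 (euclideanProj X) := by
  refine LipschitzWith.of_dist_le_mul fun y z => ?_
  have hy := inner_sub_euclideanProj_nonpos hconvex hclosed y (euclideanProj_mem hclosed hne z)
  have hz := inner_sub_euclideanProj_nonpos hconvex hclosed z (euclideanProj_mem hclosed hne y)
  set p := euclideanProj X y
  set q := euclideanProj X z
  have hfirm : ‖p - q‖ * ‖p - q‖ ≤ ‖y - z‖ * ‖p - q‖ :=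
    calc ‖p - q‖ * ‖p - q‖ = inner ℝ (p - q) (p - q) := (real_inner_self_eq_norm_mul_norm _).symm
      _ = inner ℝ (y - z) (p - q) + inner ℝ (y - p) (q - p) + inner ℝ (z - q) (p - q) := by
        rw [← neg_sub p q, inner_neg_right, ← sub_eq_add_neg, ← inner_sub_left, ← inner_add_left]
        congr 1
        abel
      _ ≤ inner ℝ (y - z) (p - q) := by linarith
      _ ≤ ‖y - z‖ * ‖p - q‖ := real_inner_le_norm _ _
  rw [NNReal.coe_one, one_mul, dist_eq_norm, dist_eq_norm]
  rcases (norm_nonneg (p - q)).eq_or_lt with heq | hpos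
  · exact heq ▸ norm_nonneg _
  · exact le_of_mul_le_mul_right hfirm hpos

end Projection

section Estimators

variable {d : ℕ} {X : Set (EuclideanSpace ℝ (Fin d))} {η δ D : ℝ}
  {f f' : EuclideanSpace ℝ (Fin d) → ℝ} {x x' v v' : EuclideanSpace ℝ (Fin d)} {L : ℝ≥0}

theorem add_smul_mem_cthickening (hδ : 0 ≤ δ) (hx : x ∈ X) (hv : ‖v‖ = 1) :
    x + δ • v ∈ Metric.cthickening δ X := by
  refine Metric.mem_cthickening_of_dist_le _ x δ X hx ?_
  simp [norm_smul, hv, abs_of_nonneg hδ]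

theorem sub_smul_mem_cthickening (hδ : 0 ≤ δ) (hx : x ∈ X) (hv : ‖v‖ = 1) :
    x - δ • v ∈ Metric.cthickening δ X := by
  simpa [sub_eq_add_neg] using add_smul_mem_cthickening hδ hx (v := -v) (by simpa using hv)

theorem lipschitzOnWith_symmetricDifference (hδ : 0 ≤ δ)
    (hf : LipschitzOnWith L f (Metric.cthickening δ X)) (hx : x ∈ X) :
    LipschitzOnWith (2 * δ.toNNReal * L) (fun v => f (x + δ • v) - f (x - δ • v))
      (Metric.sphere 0 1) := by
  have hsmul : LipschitzWith δ.toNNReal fun v : EuclideanSpace ℝ (Fin d) => δ • v := by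
    simpa [Real.nnnorm_of_nonneg hδ, Real.toNNReal_of_nonneg hδ] using lipschitzWith_smul δ
  have hadd := hf.comp
    (((LipschitzWith.const x).add hsmul).lipschitzOnWith (s := Metric.sphere 0 1))
    fun v hv => add_smul_mem_cthickening hδ hx (by simpa using hv)
  have hsub := hf.comp
    (((LipschitzWith.const x).sub hsmul).lipschitzOnWith (s := Metric.sphere 0 1))
    fun v hv => sub_smul_mem_cthickening hδ hx (by simpa using hv)
  exact (hadd.sub hsub).weaken (by rw [zero_add]; exact le_of_eq (by ring))

theorem norm_twoPointEstimator (hδ : 0 ≤ δ) (hv : ‖v‖ = 1) :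
    ‖twoPointEstimator δ f x v‖ = d / (2 * δ) * |f (x + δ • v) - f (x - δ • v)| := by
  rw [twoPointEstimator, norm_smul, hv, mul_one, Real.norm_eq_abs, abs_mul,
    abs_of_nonneg (by positivity)]

theorem norm_residualEstimator (hδ : 0 ≤ δ) (hv : ‖v‖ = 1) :
    ‖residualEstimator δ f f' x v x' v'‖ =
      d / δ * |f (x + δ • v) - f' (x' + δ • v')| := by
  rw [residualEstimator, norm_smul, hv, mul_one, Real.norm_eq_abs, abs_mul,
    abs_of_nonneg (by positivity)]

theorem norm_twoPointEstimator_le (hδ : 0 < δ) (hf : LipschitzOnWith L f (Metric.cthickening δ X))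
    (hx : x ∈ X) (hv : ‖v‖ = 1) : ‖twoPointEstimator δ f x v‖ ≤ d * L := by
  have hlip : |f (x + δ • v) - f (x - δ • v)| ≤ L * (2 * δ) :=
    calc |f (x + δ • v) - f (x - δ • v)| ≤ L * ‖x + δ • v - (x - δ • v)‖ := by
          simpa [Real.dist_eq, dist_eq_norm] using
            hf.dist_le_mul _ (add_smul_mem_cthickening hδ.le hx hv) _
              (sub_smul_mem_cthickening hδ.le hx hv)
      _ = L * ‖(2 * δ) • v‖ := by congr 2; module
      _ = L * (2 * δ) := by rw [norm_smul, hv, mul_one, Real.norm_of_nonneg (by positivity)]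
  rw [norm_twoPointEstimator hδ.le hv]
  calc d / (2 * δ) * |f (x + δ • v) - f (x - δ • v)| ≤ d / (2 * δ) * (L * (2 * δ)) := by gcongr
    _ = d * L := by field_simp

theorem integral_sq_norm_twoPointEstimator_le (hδ : 0 < δ)
    (hf : LipschitzOnWith L f (Metric.cthickening δ X)) (hx : x ∈ X) :
    ∫ s, ‖twoPointEstimator δ f x s.1‖ ^ 2 ∂(uniformSphere d) ≤ 23 * d * (L : ℝ) ^ 2 := by
  rcases eq_or_ne d 0 with rfl | hd
  · simp [twoPointEstimator]
  have hodd : ∀ v ∈ Metric.sphere (0 : EuclideanSpace ℝ (Fin d)) 1,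
      f (x + δ • -v) - f (x - δ • -v) = -(f (x + δ • v) - f (x - δ • v)) := fun v _ => by
    rw [smul_neg, sub_neg_eq_add, ← sub_eq_add_neg, neg_sub]
  have hmoment := integral_sq_uniformSphere_le_of_odd hd
    (lipschitzOnWith_symmetricDifference hδ.le hf hx) hodd
  push_cast at hmoment
  rw [Real.coe_toNNReal _ hδ.le] at hmoment
  have hd' : (d : ℝ) ≠ 0 := by exact_mod_cast hd
  calc ∫ s, ‖twoPointEstimator δ f x s.1‖ ^ 2 ∂(uniformSphere d)
      = (d / (2 * δ)) ^ 2 * ∫ s, (f (x + δ • s.1) - f (x - δ • s.1)) ^ 2 ∂(uniformSphere d) := by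
        rw [← integral_const_mul]
        congr 1 with s
        rw [norm_twoPointEstimator hδ.le (by simp), mul_pow, sq_abs]
    _ ≤ (d / (2 * δ)) ^ 2 * (23 * (2 * δ * L) ^ 2 / d) := by gcongr
    _ = 23 * d * (L : ℝ) ^ 2 := by field_simp

theorem le_mul_of_ofReal_div_ofReal_le {a b c : ℝ} (hb : 0 ≤ b) (hc : 0 ≤ c)
    (h : ENNReal.ofReal a / ENNReal.ofReal b ≤ ENNReal.ofReal c) : a ≤ c * b := by
  rw [ENNReal.div_le_iff_le_mul (.inr ENNReal.ofReal_ne_top) (.inl ENNReal.ofReal_ne_top),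
    ← ENNReal.ofReal_mul hc] at h
  exact (ENNReal.ofReal_le_ofReal_iff (by positivity)).1 h

theorem norm_lazyEstimator_temporalVariationA_le_or_eq (hδ : 0 < δ) (hD : 0 ≤ D)
    (hv : ‖v‖ = 1) (hv' : ‖v'‖ = 1) :
    ‖lazyEstimator temporalVariationA δ D f f' x v x' v'‖ ≤ d / δ * (D * (‖x - x'‖ + 2 * δ)) ∨
    lazyEstimator temporalVariationA δ D f f' x v x' v' = twoPointEstimator δ f x v := by
  have hquery : ‖x + δ • v - (x' + δ • v')‖ ≤ ‖x - x'‖ + 2 * δ :=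
    calc ‖x + δ • v - (x' + δ • v')‖ = ‖(x - x') + (δ • v - δ • v')‖ := by congr 1; abel
      _ ≤ ‖x - x'‖ + (‖δ • v‖ + ‖δ • v'‖) :=
        (norm_add_le _ _).trans (by gcongr; exact norm_sub_le _ _)
      _ = ‖x - x'‖ + 2 * δ := by
        rw [norm_smul, norm_smul, hv, hv', Real.norm_of_nonneg hδ.le]
        ring
  unfold lazyEstimator
  split_ifs with hlazy
  · refine .inl ?_
    rw [norm_residualEstimator hδ.le hv]
    gcongr
    exact (le_mul_of_ofReal_div_ofReal_le (norm_nonneg _) hD hlazy).trans (by gcongr)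
  · exact .inr rfl

theorem norm_lazyEstimator_temporalVariationB_le_or_eq (hδ : 0 ≤ δ) (hD : 0 ≤ D) (hη : 0 ≤ η)
    (hv : ‖v‖ = 1) :
    ‖lazyEstimator (temporalVariationB η L) δ D f f' x v x' v'‖ ≤ d / δ * (D * (η * L)) ∨
    lazyEstimator (temporalVariationB η L) δ D f f' x v x' v' = twoPointEstimator δ f x v := by
  unfold lazyEstimator
  split_ifs with hlazy
  · refine .inl ?_
    rw [norm_residualEstimator hδ hv]
    gcongr
    exact le_mul_of_ofReal_div_ofReal_le (by positivity) hD hlazy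
  · exact .inr rfl

end Estimators

/-- The sequences `x` of iterates and `g` of gradient estimates are those of the lazy method with
temporal variation `V` on the losses `f` and the directions `u`. Unlike `lazoRun` itself, this
names the two components of the run separately. -/
def IsLazoTrajectory {d : ℕ}
    (V : (EuclideanSpace ℝ (Fin d) → ℝ) → (EuclideanSpace ℝ (Fin d) → ℝ) →
      EuclideanSpace ℝ (Fin d) → EuclideanSpace ℝ (Fin d) → ℝ≥0∞)
    (X : Set (EuclideanSpace ℝ (Fin d))) (x₀ : EuclideanSpace ℝ (Fin d)) (η δ D : ℝ)
    (f : ℕ → EuclideanSpace ℝ (Fin d) → ℝ) (u x g : ℕ → EuclideanSpace ℝ (Fin d)) : Prop :=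
  ∀ t, (x t, g t) = lazoRun V X x₀ η δ D f u t

namespace IsLazoTrajectory

variable {d : ℕ}
  {V : (EuclideanSpace ℝ (Fin d) → ℝ) → (EuclideanSpace ℝ (Fin d) → ℝ) →
    EuclideanSpace ℝ (Fin d) → EuclideanSpace ℝ (Fin d) → ℝ≥0∞}
  {X : Set (EuclideanSpace ℝ (Fin d))} {x₀ : EuclideanSpace ℝ (Fin d)} {η δ D : ℝ}
  {f : ℕ → EuclideanSpace ℝ (Fin d) → ℝ} {u x g : ℕ → EuclideanSpace ℝ (Fin d)} {L : ℝ≥0}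

theorem iterate_zero (h : IsLazoTrajectory V X x₀ η δ D f u x g) : x 0 = x₀ :=
  congrArg Prod.fst (h 0)

theorem estimate_zero (h : IsLazoTrajectory V X x₀ η δ D f u x g) :
    g 0 = twoPointEstimator δ (f 0) (x 0) (u 0) :=
  h.iterate_zero ▸ congrArg Prod.snd (h 0)

theorem iterate_succ (h : IsLazoTrajectory V X x₀ η δ D f u x g) (t : ℕ) :
    x (t + 1) = euclideanProj X (x t - η • g t) := by
  have hfst := congrArg Prod.fst (h (t + 1))
  rwa [lazoRun, ← h t] at hfst

theorem estimate_succ (h : IsLazoTrajectory V X x₀ η δ D f u x g) (t : ℕ) :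
    g (t + 1) = lazyEstimator V δ D (f (t + 1)) (f t) (x (t + 1)) (u (t + 1)) (x t) (u t) := by
  have hsnd := congrArg Prod.snd (h (t + 1))
  rwa [lazoRun, ← h t, ← h.iterate_succ t] at hsnd

theorem iterate_mem (h : IsLazoTrajectory V X x₀ η δ D f u x g) (hclosed : IsClosed X)
    (hx₀ : x₀ ∈ X) (t : ℕ) : x t ∈ X := by
  cases t with
  | zero => exact h.iterate_zero ▸ hx₀
  | succ t => exact h.iterate_succ t ▸ euclideanProj_mem hclosed ⟨x₀, hx₀⟩ _

theorem norm_iterate_succ_sub_le (h : IsLazoTrajectory V X x₀ η δ D f u x g)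
    (hconvex : Convex ℝ X) (hclosed : IsClosed X) (hx₀ : x₀ ∈ X) (hη : 0 ≤ η) (t : ℕ) :
    ‖x (t + 1) - x t‖ ≤ η * ‖g t‖ :=
  calc ‖x (t + 1) - x t‖
      = ‖euclideanProj X (x t - η • g t) - euclideanProj X (x t)‖ := by
        rw [h.iterate_succ, euclideanProj_of_mem hclosed (h.iterate_mem hclosed hx₀ t)]
    _ ≤ ‖x t - η • g t - x t‖ := by
        simpa using (lipschitzWith_euclideanProj hconvex hclosed ⟨x₀, hx₀⟩).norm_sub_le
          (x t - η • g t) (x t)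
    _ = η * ‖g t‖ := by rw [sub_sub_cancel_left, norm_neg, norm_smul, Real.norm_of_nonneg hη]

theorem sq_norm_estimate_succ_le_or_eq_temporalVariationA
    (h : IsLazoTrajectory temporalVariationA X x₀ η δ D f u x g) (hconvex : Convex ℝ X)
    (hclosed : IsClosed X) (hx₀ : x₀ ∈ X) (hη : 0 ≤ η) (hδ : 0 < δ) (hD : 0 ≤ D)
    (hu : ∀ t, ‖u t‖ = 1) (t : ℕ) :
    ‖g (t + 1)‖ ^ 2 ≤ 2 * (d : ℝ) ^ 2 * D ^ 2 * η ^ 2 / δ ^ 2 * ‖g t‖ ^ 2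
        + 8 * (d : ℝ) ^ 2 * D ^ 2 ∨
      g (t + 1) = twoPointEstimator δ (f (t + 1)) (x (t + 1)) (u (t + 1)) := by
  rw [h.estimate_succ t]
  refine (norm_lazyEstimator_temporalVariationA_le_or_eq hδ hD (hu _) (hu _)).imp_left
    fun hlazy => ?_
  have hmove := h.norm_iterate_succ_sub_le hconvex hclosed hx₀ hη t
  calc _ ≤ (d / δ * (D * (‖x (t + 1) - x t‖ + 2 * δ))) ^ 2 := by gcongr
    _ ≤ (d / δ * (D * (η * ‖g t‖ + 2 * δ))) ^ 2 := by gcongr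
    _ = (d / δ * D) ^ 2 * (η * ‖g t‖ + 2 * δ) ^ 2 := by ring
    _ ≤ (d / δ * D) ^ 2 * (2 * ((η * ‖g t‖) ^ 2 + (2 * δ) ^ 2)) := by
      gcongr
      exact add_sq_le
    _ = _ := by field_simp; ring

theorem norm_estimate_le_temporalVariationA
    (h : IsLazoTrajectory temporalVariationA X x₀ η δ D f u x g)
    (hconvex : Convex ℝ X) (hclosed : IsClosed X) (hx₀ : x₀ ∈ X) (hη : 0 ≤ η) (hδ : 0 < δ)
    (hD : 0 ≤ D) (hu : ∀ t, ‖u t‖ = 1) (hratio : η / δ * (d * L) = 1)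
    (hDL : 10 * D ^ 2 ≤ (L : ℝ) ^ 2) {T : ℕ}
    (hf : ∀ t ≤ T, LipschitzOnWith L (f t) (Metric.cthickening δ X)) :
    ∀ t ≤ T, ‖g t‖ ≤ d * L := by
  have htwoPoint (t : ℕ) (ht : t ≤ T) : ‖twoPointEstimator δ (f t) (x t) (u t)‖ ≤ d * L :=
    norm_twoPointEstimator_le hδ (hf t ht) (h.iterate_mem hclosed hx₀ t) (hu t)
  intro t
  induction t with
  | zero => exact fun ht => h.estimate_zero ▸ htwoPoint 0 ht
  | succ t ih =>
    intro ht
    rcases h.sq_norm_estimate_succ_le_or_eq_temporalVariationA hconvex hclosed hx₀ hη hδ hD hu t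
      with hlazy | heq
    · have hprev := ih (by lia)
      refine le_of_sq_le_sq (hlazy.trans ?_) (by positivity)
      calc 2 * (d : ℝ) ^ 2 * D ^ 2 * η ^ 2 / δ ^ 2 * ‖g t‖ ^ 2 + 8 * (d : ℝ) ^ 2 * D ^ 2
          ≤ 2 * (d : ℝ) ^ 2 * D ^ 2 * η ^ 2 / δ ^ 2 * (d * L) ^ 2 + 8 * (d : ℝ) ^ 2 * D ^ 2 := by
            gcongr
        _ = (d : ℝ) ^ 2 * D ^ 2 * (2 * (η / δ * (d * L)) ^ 2 + 8) := by ring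
        _ = (d : ℝ) ^ 2 * (10 * D ^ 2) := by rw [hratio]; ring
        _ ≤ (d : ℝ) ^ 2 * (L : ℝ) ^ 2 := by gcongr
        _ = (d * L : ℝ) ^ 2 := by ring
    · exact heq ▸ htwoPoint _ ht

theorem sq_norm_estimate_le_or_eq_temporalVariationB
    (h : IsLazoTrajectory (temporalVariationB η L) X x₀ η δ D f u x g) (hη : 0 ≤ η) (hδ : 0 ≤ δ)
    (hD : 0 ≤ D) (hu : ∀ t, ‖u t‖ = 1) (t : ℕ) :
    ‖g t‖ ^ 2 ≤ D ^ 2 * η ^ 2 * (d : ℝ) ^ 2 * (L : ℝ) ^ 2 / δ ^ 2 ∨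
      g t = twoPointEstimator δ (f t) (x t) (u t) := by
  cases t with
  | zero => exact .inr h.estimate_zero
  | succ t =>
    rw [h.estimate_succ t]
    refine (norm_lazyEstimator_temporalVariationB_le_or_eq hδ hD hη (hu _)).imp_left
      fun hlazy => ?_
    calc _ ≤ (d / δ * (D * (η * L))) ^ 2 := by gcongr
      _ = D ^ 2 * η ^ 2 * (d : ℝ) ^ 2 * (L : ℝ) ^ 2 / δ ^ 2 := by ring

end IsLazoTrajectory

section CondExp

variable {Ω S : Type*} {m m' mΩ : MeasurableSpace Ω} [MeasurableSpace S] {μ : Measure Ω}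

theorem condExp_prodMk_ae_eq_integral_of_indepFun [IsProbabilityMeasure μ] {Ω' : Type*}
    {mΩ' : MeasurableSpace Ω'} {Z : Ω → Ω'} {U : Ω → S} (hZ : Measurable Z) (hU : Measurable U)
    (hindep : IndepFun Z U μ) {φ : Ω' × S → ℝ} (hφ : Measurable φ)
    (hint : Integrable (fun ω => φ (Z ω, U ω)) μ) :
    μ[fun ω => φ (Z ω, U ω) | mΩ'.comap Z] =ᵐ[μ] fun ω => ∫ s, φ (Z ω, s) ∂(μ.map U) := by
  have hmap := (indepFun_iff_map_prod_eq_prod_map_map hZ.aemeasurable hU.aemeasurable).1 hindep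
  have hint' : Integrable φ ((μ.map Z).prod (μ.map U)) := by
    rwa [← hmap, integrable_map_measure hφ.aestronglyMeasurable (hZ.prodMk hU).aemeasurable]
  have hinner : StronglyMeasurable fun z => ∫ s, φ (z, s) ∂(μ.map U) :=
    hφ.stronglyMeasurable.integral_prod_right'
  refine (ae_eq_condExp_of_forall_setIntegral_eq hZ.comap_le hint
    (fun s _ _ => (hint'.integral_prod_left.comp_measurable hZ).integrableOn) ?_
    (hinner.comp_measurable (comap_measurable Z)).aestronglyMeasurable).symm
  rintro _ ⟨B, hB, rfl⟩ -
  calc ∫ ω in Z ⁻¹' B, (∫ s, φ (Z ω, s) ∂(μ.map U)) ∂μ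
      = ∫ z in B, (∫ s, φ (z, s) ∂(μ.map U)) ∂(μ.map Z) :=
        (setIntegral_map hB hinner.aestronglyMeasurable hZ.aemeasurable).symm
    _ = ∫ p in B ×ˢ Set.univ, φ p ∂((μ.map Z).prod (μ.map U)) := by
        rw [setIntegral_prod _ hint'.integrableOn, Measure.restrict_univ]
    _ = ∫ ω in Z ⁻¹' B, φ (Z ω, U ω) ∂μ := by
        rw [← hmap, setIntegral_map (hB.prod .univ) hφ.aestronglyMeasurable
          (hZ.prodMk hU).aemeasurable, Set.mk_preimage_prod, Set.preimage_univ, Set.inter_univ]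

theorem condExp_prodMk_ae_le_of_indep [IsProbabilityMeasure μ] (hm : m ≤ mΩ) {U : Ω → S}
    (hU : Measurable U) (hindep : Indep (MeasurableSpace.comap U inferInstance) m μ)
    {φ : Ω × S → ℝ} (hφ : Measurable[m.prod inferInstance] φ)
    (hint : Integrable (fun ω => φ (ω, U ω)) μ) {C : ℝ}
    (hC : ∀ ω, ∫ s, φ (ω, s) ∂(μ.map U) ≤ C) :
    μ[fun ω => φ (ω, U ω) | m] ≤ᵐ[μ] fun _ => C := by
  -- As a map into `Ω` equipped with `m`, the identity generates exactly `m`.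
  have hid : @Measurable Ω Ω mΩ m id := fun s hs => hm s hs
  have hindep_id : @IndepFun Ω Ω S mΩ m _ id U μ :=
    (@IndepFun_iff_Indep Ω Ω S mΩ m _ id U μ).2
      (by rw [MeasurableSpace.comap_id]; exact hindep.symm)
  have h := condExp_prodMk_ae_eq_integral_of_indepFun (mΩ' := m) (Z := id) hid hU hindep_id hφ hint
  rw [MeasurableSpace.comap_id] at h
  exact h.le.trans (.of_forall hC)

theorem condExp_ae_le_add_of_le_add (hm : m ≤ mΩ) [SigmaFinite (μ.trim hm)] {Y A Z : Ω → ℝ}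
    {C : ℝ} (hY : Integrable Y μ) (hA : Integrable A μ) (hAm : StronglyMeasurable[m] A)
    (hZ : Integrable Z μ) (hle : Y ≤ᵐ[μ] A + Z) (hC : μ[Z | m] ≤ᵐ[μ] fun _ => C) :
    μ[Y | m] ≤ᵐ[μ] fun ω => A ω + C := by
  have hadd := condExp_add hA hZ m
  rw [condExp_of_stronglyMeasurable hm hAm hA] at hadd
  filter_upwards [condExp_mono (m := m) hY (hA.add hZ) hle, hadd, hC] with ω hYω haddω hCω
  rw [haddω, Pi.add_apply] at hYω
  exact hYω.trans (by gcongr)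

theorem condExp_ae_le_condExp_of_le (hmm' : m ≤ m') (hm' : m' ≤ mΩ) [SigmaFinite (μ.trim hm')]
    {Y Z : Ω → ℝ} (hZ : Integrable Z μ) (h : μ[Y | m'] ≤ᵐ[μ] Z) : μ[Y | m] ≤ᵐ[μ] μ[Z | m] :=
  (condExp_condExp_of_le hmm' hm').symm.le.trans (condExp_mono integrable_condExp hZ h)

theorem condExp_ae_le_const_of_le [IsFiniteMeasure μ] (hmm' : m ≤ m') (hm' : m' ≤ mΩ)
    {Y : Ω → ℝ} {C : ℝ} (h : μ[Y | m'] ≤ᵐ[μ] fun _ => C) : μ[Y | m] ≤ᵐ[μ] fun _ => C := by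
  simpa only [condExp_const (hmm'.trans hm')] using
    condExp_ae_le_condExp_of_le hmm' hm' (integrable_const C) h

theorem condExp_ae_le_affine_of_le [IsFiniteMeasure μ] (hmm' : m ≤ m') (hm' : m' ≤ mΩ)
    {Y W : Ω → ℝ} {a k b : ℝ} (hW : Integrable W μ)
    (h : μ[Y | m'] ≤ᵐ[μ] fun ω => a + k * W ω + b) :
    μ[Y | m] ≤ᵐ[μ] fun ω => a + k * (μ[W | m]) ω + b := by
  have hconst (c : ℝ) : Integrable (fun _ : Ω => c) μ := integrable_const c
  have haffine : μ[fun ω => a + k * W ω + b | m] =ᵐ[μ] fun ω => a + k * (μ[W | m]) ω + b := by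
    filter_upwards [condExp_add ((hconst a).add (hW.const_mul k)) (hconst b) m,
      condExp_add (hconst a) (hW.const_mul k) m, condExp_smul k W m] with ω hadd hadd' hsmul
    simp only [Pi.add_apply, condExp_const (hmm'.trans hm')] at hadd hadd'
    exact hadd.trans (by rw [hadd']; exact congrArg (a + · + b) hsmul)
  exact (condExp_ae_le_condExp_of_le hmm' hm'
    (((hconst a).add (hW.const_mul k)).add (hconst b)) h).trans haffine.le

end CondExp

section Measurability

variable {d : ℕ} {Ω : Type*} {mΩ : MeasurableSpace Ω} {X : Set (EuclideanSpace ℝ (Fin d))}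
  {δ : ℝ} {f : Ω → EuclideanSpace ℝ (Fin d) → ℝ} {x v : Ω → EuclideanSpace ℝ (Fin d)}

theorem measurable_eval_of_continuousOn {E : Type*} [TopologicalSpace E]
    [TopologicalSpace.MetrizableSpace E] [SecondCountableTopology E] [MeasurableSpace E]
    [OpensMeasurableSpace E] {Y : Set E} {f : Ω → E → ℝ}
    (hf : ∀ y ∈ Y, Measurable fun ω => f ω y) (hcont : ∀ ω, ContinuousOn (f ω) Y) {z : Ω → E}
    (hz : Measurable z) (hzY : ∀ ω, z ω ∈ Y) : Measurable fun ω => f ω (z ω) :=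
  (measurable_uncurry_of_continuous_of_measurable (u := fun (y : Y) ω => f ω y)
    (fun ω => (hcont ω).domRestrict) fun y => hf y y.2).comp
      ((hz.subtype_mk (h := hzY)).prodMk measurable_id)

theorem measurable_twoPointEstimator (hδ : 0 ≤ δ)
    (hf : ∀ y ∈ Metric.cthickening δ X, Measurable fun ω => f ω y)
    (hcont : ∀ ω, ContinuousOn (f ω) (Metric.cthickening δ X)) (hx : Measurable x)
    (hv : Measurable v) (hxX : ∀ ω, x ω ∈ X) (hv1 : ∀ ω, ‖v ω‖ = 1) :
    Measurable fun ω => twoPointEstimator δ (f ω) (x ω) (v ω) := by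
  have hadd := measurable_eval_of_continuousOn hf hcont (hx.add (hv.const_smul δ))
    fun ω => add_smul_mem_cthickening hδ (hxX ω) (hv1 ω)
  have hsub := measurable_eval_of_continuousOn hf hcont (hx.sub (hv.const_smul δ))
    fun ω => sub_smul_mem_cthickening hδ (hxX ω) (hv1 ω)
  exact ((hadd.sub hsub).const_mul _).smul hv

/-- The temporal variation `V f f' y y'` depends measurably on the loss values `f y`, `f' y'` and
the query points `y`, `y'`, and on nothing else; this makes the lazy estimates random variables. -/
def IsMeasurableVariation {d : ℕ}
    (V : (EuclideanSpace ℝ (Fin d) → ℝ) → (EuclideanSpace ℝ (Fin d) → ℝ) →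
      EuclideanSpace ℝ (Fin d) → EuclideanSpace ℝ (Fin d) → ℝ≥0∞) : Prop :=
  ∃ W : ℝ × ℝ × EuclideanSpace ℝ (Fin d) × EuclideanSpace ℝ (Fin d) → ℝ≥0∞,
    Measurable W ∧ ∀ f f' y y', V f f' y y' = W (f y, f' y', y, y')

theorem isMeasurableVariation_temporalVariationA :
    IsMeasurableVariation (temporalVariationA (d := d)) :=
  ⟨fun q => ENNReal.ofReal |q.1 - q.2.1| / ENNReal.ofReal ‖q.2.2.1 - q.2.2.2‖, by fun_prop,
    fun _ _ _ _ => rfl⟩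

theorem isMeasurableVariation_temporalVariationB (η L : ℝ) :
    IsMeasurableVariation (temporalVariationB (d := d) η L) :=
  ⟨fun q => ENNReal.ofReal |q.1 - q.2.1| / ENNReal.ofReal (η * L), by fun_prop,
    fun _ _ _ _ => rfl⟩

theorem measurable_lazyEstimator
    {V : (EuclideanSpace ℝ (Fin d) → ℝ) → (EuclideanSpace ℝ (Fin d) → ℝ) →
      EuclideanSpace ℝ (Fin d) → EuclideanSpace ℝ (Fin d) → ℝ≥0∞}
    (hV : IsMeasurableVariation V) {D : ℝ} {f' : Ω → EuclideanSpace ℝ (Fin d) → ℝ}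
    {x' v' : Ω → EuclideanSpace ℝ (Fin d)} (hx : Measurable x) (hv : Measurable v)
    (hx' : Measurable x') (hv' : Measurable v')
    (hloss : Measurable fun ω => f ω (x ω + δ • v ω))
    (hloss' : Measurable fun ω => f' ω (x' ω + δ • v' ω))
    (htwoPoint : Measurable fun ω => twoPointEstimator δ (f ω) (x ω) (v ω)) :
    Measurable fun ω => lazyEstimator V δ D (f ω) (f' ω) (x ω) (v ω) (x' ω) (v' ω) := by
  obtain ⟨W, hW, hVW⟩ := hV
  have hvariation : Measurable fun ω => V (f ω) (f' ω) (x ω + δ • v ω) (x' ω + δ • v' ω) := by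
    simp only [hVW]
    exact hW.comp (hloss.prodMk (hloss'.prodMk
      ((hx.add (hv.const_smul δ)).prodMk (hx'.add (hv'.const_smul δ)))))
  exact Measurable.ite (measurableSet_le hvariation measurable_const)
    (((hloss.sub hloss').const_mul _).smul hv) htwoPoint

end Measurability

/-- The stochastic setting of a lazy method: the random directions `u t` are uniform on the sphere
and independent of the past `ℱ t`, which determines the loss `f t`; all losses up to round `T` are
`L`-Lipschitz on the `δ`-neighbourhood of the closed convex set `X`, and `x`, `g` are the iterates
and estimates of the lazy method with temporal variation `V`. -/
structure IsLazyProcess {d : ℕ}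
    (V : (EuclideanSpace ℝ (Fin d) → ℝ) → (EuclideanSpace ℝ (Fin d) → ℝ) →
      EuclideanSpace ℝ (Fin d) → EuclideanSpace ℝ (Fin d) → ℝ≥0∞)
    (T : ℕ) {Ω : Type*} {mΩ : MeasurableSpace Ω} (μ : Measure Ω) (ℱ : Filtration ℕ mΩ)
    (u : ℕ → Ω → Metric.sphere (0 : EuclideanSpace ℝ (Fin d)) 1)
    (X : Set (EuclideanSpace ℝ (Fin d))) (x₀ : EuclideanSpace ℝ (Fin d)) (η δ D : ℝ) (L : ℝ≥0)
    (f : ℕ → Ω → EuclideanSpace ℝ (Fin d) → ℝ) (x g : ℕ → Ω → EuclideanSpace ℝ (Fin d)) :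
    Prop where
  measurable_dir : ∀ t ≤ T, Measurable[ℱ (t + 1)] (u t)
  law_dir : ∀ t ≤ T, μ.map (u t) = uniformSphere d
  indep_dir : ∀ t ≤ T, Indep (MeasurableSpace.comap (u t) inferInstance) (ℱ t) μ
  convex : Convex ℝ X
  closed : IsClosed X
  start_mem : x₀ ∈ X
  eta_pos : 0 < η
  delta_pos : 0 < δ
  threshold_nonneg : 0 ≤ D
  measurable_loss : ∀ t ≤ T, ∀ y ∈ Metric.cthickening δ X, Measurable[ℱ t] fun ω => f t ω y
  lipschitz_loss : ∀ t ≤ T, ∀ ω, LipschitzOnWith L (f t ω) (Metric.cthickening δ X)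
  trajectory : ∀ ω, IsLazoTrajectory V X x₀ η δ D (fun s => f s ω) (fun s => (u s ω).1)
    (fun s => x s ω) fun s => g s ω

namespace IsLazyProcess

variable {d T : ℕ}
  {V : (EuclideanSpace ℝ (Fin d) → ℝ) → (EuclideanSpace ℝ (Fin d) → ℝ) →
    EuclideanSpace ℝ (Fin d) → EuclideanSpace ℝ (Fin d) → ℝ≥0∞}
  {Ω : Type*} {mΩ : MeasurableSpace Ω} {μ : Measure Ω} {ℱ : Filtration ℕ mΩ}
  {u : ℕ → Ω → Metric.sphere (0 : EuclideanSpace ℝ (Fin d)) 1}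
  {X : Set (EuclideanSpace ℝ (Fin d))} {x₀ : EuclideanSpace ℝ (Fin d)} {η δ D : ℝ} {L : ℝ≥0}
  {f : ℕ → Ω → EuclideanSpace ℝ (Fin d) → ℝ} {x g : ℕ → Ω → EuclideanSpace ℝ (Fin d)} {t : ℕ}

theorem iterate_mem (h : IsLazyProcess V T μ ℱ u X x₀ η δ D L f x g) (t : ℕ) (ω : Ω) :
    x t ω ∈ X :=
  (h.trajectory ω).iterate_mem h.closed h.start_mem t

theorem continuousOn_loss (h : IsLazyProcess V T μ ℱ u X x₀ η δ D L f x g) (ht : t ≤ T) (ω : Ω) :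
    ContinuousOn (f t ω) (Metric.cthickening δ X) :=
  (h.lipschitz_loss t ht ω).continuousOn

theorem measurable_coe_dir (h : IsLazyProcess V T μ ℱ u X x₀ η δ D L f x g) (ht : t ≤ T) :
    Measurable[ℱ (t + 1)] fun ω => (u t ω).1 :=
  measurable_subtype_coe.comp (h.measurable_dir t ht)

theorem measurable_loss_query (h : IsLazyProcess V T μ ℱ u X x₀ η δ D L f x g) (ht : t ≤ T)
    (hx : Measurable[ℱ t] (x t)) :
    Measurable[ℱ (t + 1)] fun ω => f t ω (x t ω + δ • (u t ω).1) :=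
  measurable_eval_of_continuousOn
    (fun y hy => (h.measurable_loss t ht y hy).mono (ℱ.mono t.le_succ) le_rfl)
    (h.continuousOn_loss ht)
    ((hx.mono (ℱ.mono t.le_succ) le_rfl).add ((h.measurable_coe_dir ht).const_smul δ))
    fun ω => add_smul_mem_cthickening h.delta_pos.le (h.iterate_mem t ω)
      (norm_eq_of_mem_sphere (u t ω))

theorem measurable_twoPoint (h : IsLazyProcess V T μ ℱ u X x₀ η δ D L f x g) (ht : t ≤ T)
    (hx : Measurable[ℱ t] (x t)) :
    Measurable[ℱ (t + 1)] fun ω => twoPointEstimator δ (f t ω) (x t ω) (u t ω) :=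
  measurable_twoPointEstimator h.delta_pos.le
    (fun y hy => (h.measurable_loss t ht y hy).mono (ℱ.mono t.le_succ) le_rfl)
    (h.continuousOn_loss ht) (hx.mono (ℱ.mono t.le_succ) le_rfl) (h.measurable_coe_dir ht)
    (h.iterate_mem t) fun ω => norm_eq_of_mem_sphere (u t ω)

theorem measurable_iterate_estimate (h : IsLazyProcess V T μ ℱ u X x₀ η δ D L f x g)
    (hV : IsMeasurableVariation V) :
    ∀ t ≤ T, Measurable[ℱ t] (x t) ∧ Measurable[ℱ (t + 1)] (g t) := by
  have hproj := (lipschitzWith_euclideanProj h.convex h.closed ⟨x₀, h.start_mem⟩).continuous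
  intro t
  induction t with
  | zero =>
    intro ht
    have hx : Measurable[ℱ 0] (x 0) := by
      rw [show x 0 = fun _ => x₀ from funext fun ω => (h.trajectory ω).iterate_zero]
      exact measurable_const
    rw [show g 0 = _ from funext fun ω => (h.trajectory ω).estimate_zero]
    exact ⟨hx, h.measurable_twoPoint ht hx⟩
  | succ t ih =>
    intro ht
    have ht' : t ≤ T := by lia
    obtain ⟨hx, hg⟩ := ih ht'
    have hle : ℱ (t + 1) ≤ ℱ (t + 1 + 1) := ℱ.mono (t + 1).le_succ
    have hx' : Measurable[ℱ (t + 1)] (x t) := hx.mono (ℱ.mono t.le_succ) le_rfl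
    have hnext : Measurable[ℱ (t + 1)] (x (t + 1)) := by
      rw [show x (t + 1) = _ from funext fun ω => (h.trajectory ω).iterate_succ t]
      exact hproj.measurable.comp (hx'.sub (hg.const_smul η))
    rw [show g (t + 1) = _ from funext fun ω => (h.trajectory ω).estimate_succ t]
    exact ⟨hnext, measurable_lazyEstimator hV (hnext.mono hle le_rfl) (h.measurable_coe_dir ht)
      (hx'.mono hle le_rfl) ((h.measurable_coe_dir ht').mono hle le_rfl)
      (h.measurable_loss_query ht hnext) ((h.measurable_loss_query ht' hx).mono hle le_rfl)
      (h.measurable_twoPoint ht hnext)⟩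

theorem integrable_sq_norm_twoPoint [IsFiniteMeasure μ]
    (h : IsLazyProcess V T μ ℱ u X x₀ η δ D L f x g) (ht : t ≤ T) (hx : Measurable[ℱ t] (x t)) :
    Integrable (fun ω => ‖twoPointEstimator δ (f t ω) (x t ω) (u t ω)‖ ^ 2) μ := by
  have hmeas := (h.measurable_twoPoint ht hx).mono (ℱ.le _) le_rfl
  refine .of_bound (hmeas.norm.pow_const 2).aestronglyMeasurable ((d * L : ℝ) ^ 2)
    (.of_forall fun ω => ?_)
  rw [norm_pow, norm_norm]
  gcongr
  exact norm_twoPointEstimator_le h.delta_pos (h.lipschitz_loss t ht ω) (h.iterate_mem t ω)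
    (norm_eq_of_mem_sphere (u t ω))

theorem measurable_twoPoint_prod (h : IsLazyProcess V T μ ℱ u X x₀ η δ D L f x g) (ht : t ≤ T)
    (hx : Measurable[ℱ t] (x t)) :
    Measurable[(ℱ t).prod inferInstance]
      fun p : Ω × Metric.sphere (0 : EuclideanSpace ℝ (Fin d)) 1 =>
        twoPointEstimator δ (f t p.1) (x t p.1) p.2 :=
  have hfst : @Measurable _ _ ((ℱ t).prod inferInstance) (ℱ t)
      (Prod.fst : Ω × Metric.sphere (0 : EuclideanSpace ℝ (Fin d)) 1 → Ω) :=
    @measurable_fst _ _ (ℱ t) _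
  measurable_twoPointEstimator (mΩ := (ℱ t).prod inferInstance) h.delta_pos.le
    (fun y hy => (h.measurable_loss t ht y hy).comp hfst)
    (fun p => h.continuousOn_loss ht p.1) (hx.comp hfst)
    (measurable_subtype_coe.comp (@measurable_snd _ _ (ℱ t) _))
    (fun p => h.iterate_mem t p.1) fun p => norm_eq_of_mem_sphere p.2

theorem condExp_sq_norm_twoPoint_le [IsProbabilityMeasure μ]
    (h : IsLazyProcess V T μ ℱ u X x₀ η δ D L f x g) (ht : t ≤ T) (hx : Measurable[ℱ t] (x t)) :
    μ[fun ω => ‖twoPointEstimator δ (f t ω) (x t ω) (u t ω)‖ ^ 2 | ℱ t] ≤ᵐ[μ] fun _ =>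
      23 * d * (L : ℝ) ^ 2 := by
  have hmoment (ω : Ω) : ∫ s, ‖twoPointEstimator δ (f t ω) (x t ω) s.1‖ ^ 2 ∂(μ.map (u t)) ≤
      23 * d * (L : ℝ) ^ 2 := by
    rw [h.law_dir t ht]
    exact integral_sq_norm_twoPointEstimator_le h.delta_pos (h.lipschitz_loss t ht ω)
      (h.iterate_mem t ω)
  exact condExp_prodMk_ae_le_of_indep (ℱ.le t) ((h.measurable_dir t ht).mono (ℱ.le _) le_rfl)
    (h.indep_dir t ht) ((measurable_norm.pow_const 2).comp (h.measurable_twoPoint_prod ht hx))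
    (h.integrable_sq_norm_twoPoint ht hx) hmoment

theorem integrable_and_condExp_sq_norm_estimate_le [IsProbabilityMeasure μ]
    (h : IsLazyProcess V T μ ℱ u X x₀ η δ D L f x g) (hV : IsMeasurableVariation V) (ht : t ≤ T)
    {A : Ω → ℝ} (hA0 : ∀ ω, 0 ≤ A ω) (hAm : Measurable[ℱ t] A) (hA : Integrable A μ)
    (hle : ∀ ω, ‖g t ω‖ ^ 2 ≤ A ω ∨ g t ω = twoPointEstimator δ (f t ω) (x t ω) (u t ω)) :
    Integrable (fun ω => ‖g t ω‖ ^ 2) μ ∧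
      μ[fun ω => ‖g t ω‖ ^ 2 | ℱ t] ≤ᵐ[μ] fun ω => A ω + 23 * d * (L : ℝ) ^ 2 := by
  obtain ⟨hx, hg⟩ := h.measurable_iterate_estimate hV t ht
  have hZ := h.integrable_sq_norm_twoPoint ht hx
  have hadd (ω : Ω) :
      ‖g t ω‖ ^ 2 ≤ A ω + ‖twoPointEstimator δ (f t ω) (x t ω) (u t ω)‖ ^ 2 := by
    rcases hle ω with hlazy | heq
    · exact hlazy.trans (le_add_of_nonneg_right (sq_nonneg _))
    · rw [heq]
      exact le_add_of_nonneg_left (hA0 ω)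
  have hint : Integrable (fun ω => ‖g t ω‖ ^ 2) μ := by
    refine (hA.add hZ).mono'
      ((hg.mono (ℱ.le _) le_rfl).norm.pow_const 2).aestronglyMeasurable (.of_forall fun ω => ?_)
    rw [norm_pow, norm_norm]
    exact hadd ω
  exact ⟨hint, condExp_ae_le_add_of_le_add (ℱ.le t) hint hA hAm.stronglyMeasurable hZ
    (.of_forall hadd) (h.condExp_sq_norm_twoPoint_le ht hx)⟩

section TemporalVariationA

theorem integrable_and_condExp_sq_norm_estimate_succ_le_temporalVariationA
    [IsProbabilityMeasure μ] (h : IsLazyProcess temporalVariationA T μ ℱ u X x₀ η δ D L f x g)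
    (ht : t + 1 ≤ T) (hint : Integrable (fun ω => ‖g t ω‖ ^ 2) μ) :
    Integrable (fun ω => ‖g (t + 1) ω‖ ^ 2) μ ∧
      μ[fun ω => ‖g (t + 1) ω‖ ^ 2 | ℱ (t + 1)] ≤ᵐ[μ] fun ω =>
        2 * (d : ℝ) ^ 2 * D ^ 2 * η ^ 2 / δ ^ 2 * ‖g t ω‖ ^ 2 + 8 * (d : ℝ) ^ 2 * D ^ 2
          + 23 * d * (L : ℝ) ^ 2 := by
  have hg := (h.measurable_iterate_estimate isMeasurableVariation_temporalVariationA t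
    (by lia)).2
  refine h.integrable_and_condExp_sq_norm_estimate_le isMeasurableVariation_temporalVariationA ht
    (fun ω => by positivity)
    ((((measurable_norm.pow_const 2).comp hg).const_mul _).add_const _)
    ((hint.const_mul _).add (integrable_const _)) fun ω => ?_
  exact (h.trajectory ω).sq_norm_estimate_succ_le_or_eq_temporalVariationA h.convex h.closed
    h.start_mem h.eta_pos.le h.delta_pos h.threshold_nonneg
    (fun s => norm_eq_of_mem_sphere (u s ω)) t

theorem integrable_sq_norm_estimate_temporalVariationA [IsProbabilityMeasure μ]
    (h : IsLazyProcess temporalVariationA T μ ℱ u X x₀ η δ D L f x g) :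
    ∀ t ≤ T, Integrable (fun ω => ‖g t ω‖ ^ 2) μ := by
  intro t
  induction t with
  | zero =>
    intro ht
    have hx := (h.measurable_iterate_estimate isMeasurableVariation_temporalVariationA 0 ht).1
    rw [show g 0 = _ from funext fun ω => (h.trajectory ω).estimate_zero]
    exact h.integrable_sq_norm_twoPoint ht hx
  | succ t ih =>
    intro ht
    exact (h.integrable_and_condExp_sq_norm_estimate_succ_le_temporalVariationA ht
      (ih (by lia))).1

theorem condExp_sq_norm_estimate_succ_le_temporalVariationA [IsProbabilityMeasure μ]
    (h : IsLazyProcess temporalVariationA T μ ℱ u X x₀ η δ D L f x g) (ht : t + 1 ≤ T) :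
    μ[fun ω => ‖g (t + 1) ω‖ ^ 2 | ℱ (t + 1)] ≤ᵐ[μ] fun ω =>
      23 * d * (L : ℝ) ^ 2 + 2 * (d : ℝ) ^ 2 * D ^ 2 * η ^ 2 / δ ^ 2 * ‖g t ω‖ ^ 2
        + 8 * (d : ℝ) ^ 2 * D ^ 2 := by
  have hbound := (h.integrable_and_condExp_sq_norm_estimate_succ_le_temporalVariationA ht
    (h.integrable_sq_norm_estimate_temporalVariationA t (by lia))).2
  exact hbound.trans (.of_forall fun ω => by linarith)

theorem condExp_sq_norm_estimate_le_of_ratio_temporalVariationA [IsProbabilityMeasure μ]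
    (h : IsLazyProcess temporalVariationA T μ ℱ u X x₀ η δ D L f x g)
    (hratio : η / δ * (d * L) = 1) (hDL : 10 * D ^ 2 ≤ (L : ℝ) ^ 2) (ht : t ≤ T) :
    μ[fun ω => ‖g t ω‖ ^ 2 | ℱ t] ≤ᵐ[μ] fun _ =>
      23 * d * (L : ℝ) ^ 2 + 10 * (d : ℝ) ^ 2 * D ^ 2 := by
  cases t with
  | zero =>
    have hx := (h.measurable_iterate_estimate isMeasurableVariation_temporalVariationA 0 ht).1
    rw [show g 0 = _ from funext fun ω => (h.trajectory ω).estimate_zero]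
    exact (h.condExp_sq_norm_twoPoint_le ht hx).trans
      (.of_forall fun _ => le_add_of_nonneg_right (by positivity))
  | succ t =>
    refine (h.condExp_sq_norm_estimate_succ_le_temporalVariationA ht).trans
      (.of_forall fun ω => ?_)
    have hprev : ‖g t ω‖ ≤ d * L :=
      (h.trajectory ω).norm_estimate_le_temporalVariationA h.convex h.closed h.start_mem
        h.eta_pos.le h.delta_pos h.threshold_nonneg (fun s => norm_eq_of_mem_sphere (u s ω))
        hratio hDL (fun s hs => h.lipschitz_loss s hs ω) t (by lia)
    calc 23 * d * (L : ℝ) ^ 2 + 2 * (d : ℝ) ^ 2 * D ^ 2 * η ^ 2 / δ ^ 2 * ‖g t ω‖ ^ 2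
          + 8 * (d : ℝ) ^ 2 * D ^ 2
        ≤ 23 * d * (L : ℝ) ^ 2 + 2 * (d : ℝ) ^ 2 * D ^ 2 * η ^ 2 / δ ^ 2 * (d * L) ^ 2
          + 8 * (d : ℝ) ^ 2 * D ^ 2 := by gcongr
      _ = 23 * d * (L : ℝ) ^ 2 + 2 * (d : ℝ) ^ 2 * D ^ 2 * (η / δ * (d * L)) ^ 2
          + 8 * (d : ℝ) ^ 2 * D ^ 2 := by ring
      _ = 23 * d * (L : ℝ) ^ 2 + 10 * (d : ℝ) ^ 2 * D ^ 2 := by rw [hratio]; ring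

theorem condExp_sq_norm_estimate_le_of_threshold_temporalVariationA [IsProbabilityMeasure μ]
    (h : IsLazyProcess temporalVariationA T μ ℱ u X x₀ η δ D L f x g)
    (hratio : η / δ * (d * L) = 1) {K : ℝ} (hK : D ≤ K * (L / √d)) (hDL : D ≤ L / √10)
    (ht : t ≤ T) :
    μ[fun ω => ‖g t ω‖ ^ 2 | ℱ t] ≤ᵐ[μ] fun _ => (23 + 10 * K ^ 2) * d * (L : ℝ) ^ 2 := by
  have hD := h.threshold_nonneg
  have hd : (d : ℝ) ≠ 0 := fun hd => by simp [hd] at hratio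
  have hDL' : 10 * D ^ 2 ≤ (L : ℝ) ^ 2 := by
    have hsq : D ^ 2 ≤ (L / √10 : ℝ) ^ 2 := by gcongr
    rw [div_pow, Real.sq_sqrt (by norm_num)] at hsq
    linarith
  have hK' : D ^ 2 ≤ K ^ 2 * ((L : ℝ) ^ 2 / d) := by
    have hsq : D ^ 2 ≤ (K * (L / √d)) ^ 2 := by gcongr
    rwa [mul_pow, div_pow, Real.sq_sqrt d.cast_nonneg] at hsq
  refine (h.condExp_sq_norm_estimate_le_of_ratio_temporalVariationA hratio hDL' ht).trans
    (.of_forall fun _ => ?_)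
  calc 23 * d * (L : ℝ) ^ 2 + 10 * (d : ℝ) ^ 2 * D ^ 2
      ≤ 23 * d * (L : ℝ) ^ 2 + 10 * (d : ℝ) ^ 2 * (K ^ 2 * ((L : ℝ) ^ 2 / d)) := by gcongr
    _ = (23 + 10 * K ^ 2) * d * (L : ℝ) ^ 2 := by field_simp

end TemporalVariationA

section TemporalVariationB

theorem integrable_and_condExp_sq_norm_estimate_le_temporalVariationB [IsProbabilityMeasure μ]
    (h : IsLazyProcess (temporalVariationB η L) T μ ℱ u X x₀ η δ D L f x g) (ht : t ≤ T) :
    Integrable (fun ω => ‖g t ω‖ ^ 2) μ ∧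
      μ[fun ω => ‖g t ω‖ ^ 2 | ℱ t] ≤ᵐ[μ] fun _ =>
        D ^ 2 * η ^ 2 * (d : ℝ) ^ 2 * (L : ℝ) ^ 2 / δ ^ 2 + 23 * d * (L : ℝ) ^ 2 :=
  h.integrable_and_condExp_sq_norm_estimate_le (isMeasurableVariation_temporalVariationB η L) ht
    (fun _ => by positivity) measurable_const (integrable_const _) fun ω =>
      (h.trajectory ω).sq_norm_estimate_le_or_eq_temporalVariationB h.eta_pos.le h.delta_pos.le
        h.threshold_nonneg (fun s => norm_eq_of_mem_sphere (u s ω)) t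

theorem condExp_sq_norm_estimate_le_of_threshold_temporalVariationB [IsProbabilityMeasure μ]
    (h : IsLazyProcess (temporalVariationB η L) T μ ℱ u X x₀ η δ D L f x g)
    (hratio : η / δ * (d * L) = 1) {K : ℝ} (hK : D ≤ K * (√d * L)) (ht : t ≤ T) :
    μ[fun ω => ‖g t ω‖ ^ 2 | ℱ t] ≤ᵐ[μ] fun _ => (23 + K ^ 2) * d * (L : ℝ) ^ 2 := by
  have hD := h.threshold_nonneg
  have hK' : D ^ 2 ≤ K ^ 2 * (d * (L : ℝ) ^ 2) := by
    have hsq : D ^ 2 ≤ (K * (√d * L)) ^ 2 := by gcongr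
    rwa [mul_pow, mul_pow, Real.sq_sqrt d.cast_nonneg] at hsq
  refine (h.integrable_and_condExp_sq_norm_estimate_le_temporalVariationB ht).2.trans
    (.of_forall fun _ => ?_)
  calc D ^ 2 * η ^ 2 * (d : ℝ) ^ 2 * (L : ℝ) ^ 2 / δ ^ 2 + 23 * d * (L : ℝ) ^ 2
      = D ^ 2 * (η / δ * (d * L)) ^ 2 + 23 * d * (L : ℝ) ^ 2 := by ring
    _ = D ^ 2 + 23 * d * (L : ℝ) ^ 2 := by rw [hratio]; ring
    _ ≤ (23 + K ^ 2) * d * (L : ℝ) ^ 2 := by linarith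

end TemporalVariationB

end IsLazyProcess

theorem stepSize_div_smoothingRadius {R L d T η δ : ℝ} (hd : 0 ≤ d) (hη : 0 < η) (hδ : 0 < δ)
    (hη_eq : η = R / (L * √(d * T))) (hδ_eq : δ = R * √(d / T)) : η / δ * (d * L) = 1 := by
  have hR : R ≠ 0 := by rintro rfl; simp [hδ_eq] at hδ
  have hL : L ≠ 0 := by rintro rfl; simp [hη_eq] at hη
  have hroot : √(d * T) ≠ 0 := fun h0 => by simp [hη_eq, h0] at hη
  have hprod : √(d * T) * √(d / T) = d := by
    have hdT : 0 < d * T := Real.sqrt_ne_zero'.1 hroot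
    have hT : T ≠ 0 := right_ne_zero_of_mul hdT.ne'
    rw [← Real.sqrt_mul hdT.le, show d * T * (d / T) = d ^ 2 by field_simp, Real.sqrt_sq hd]
  have hroot' : √(d / T) ≠ 0 := fun h0 => by simp [hδ_eq, h0] at hδ
  calc η / δ * (d * L) = R / (L * √(d * T)) / (R * √(d / T)) * ((√(d * T) * √(d / T)) * L) := by
        rw [hprod, hη_eq, hδ_eq]
    _ = 1 := by field_simp

theorem lemma4_general {d T : ℕ} {Ω : Type*} {mΩ : MeasurableSpace Ω} {μ : Measure Ω}
    [IsProbabilityMeasure μ] {ℱ : Filtration ℕ mΩ}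
    {u : ℕ → Ω → Metric.sphere (0 : EuclideanSpace ℝ (Fin d)) 1}
    {X : Set (EuclideanSpace ℝ (Fin d))} {x₀ : EuclideanSpace ℝ (Fin d)} {η δ D : ℝ} {L : ℝ≥0}
    {f : ℕ → Ω → EuclideanSpace ℝ (Fin d) → ℝ} {xa ga xb gb : ℕ → Ω → EuclideanSpace ℝ (Fin d)}
    (ha : IsLazyProcess temporalVariationA T μ ℱ u X x₀ η δ D L f xa ga)
    (hb : IsLazyProcess (temporalVariationB η L) T μ ℱ u X x₀ η δ D L f xb gb) (R : ℝ) :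
    (∀ t ≤ T, Measurable[ℱ t] (xa t) ∧ Integrable (fun ω => ‖ga t ω‖ ^ 2) μ ∧
      Measurable[ℱ t] (xb t) ∧ Integrable (fun ω => ‖gb t ω‖ ^ 2) μ) ∧
    (∀ t, t + 1 ≤ T →
      μ[fun ω => ‖ga (t + 1) ω‖ ^ 2 | ℱ (t + 1)] ≤ᵐ[μ] fun ω =>
        23 * d * (L : ℝ) ^ 2 + 2 * (d : ℝ) ^ 2 * D ^ 2 * η ^ 2 / δ ^ 2 * ‖ga t ω‖ ^ 2
          + 8 * (d : ℝ) ^ 2 * D ^ 2) ∧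
    (∀ t, t + 1 ≤ T →
      μ[fun ω => ‖ga (t + 1) ω‖ ^ 2 | MeasurableSpace.comap (xa (t + 1)) inferInstance]
        ≤ᵐ[μ] fun ω =>
        23 * d * (L : ℝ) ^ 2 + 2 * (d : ℝ) ^ 2 * D ^ 2 * η ^ 2 / δ ^ 2 *
            (μ[fun ω' => ‖ga t ω'‖ ^ 2 |
              MeasurableSpace.comap (xa (t + 1)) inferInstance]) ω
          + 8 * (d : ℝ) ^ 2 * D ^ 2) ∧
    (∀ t ≤ T,
      μ[fun ω => ‖gb t ω‖ ^ 2 | ℱ t] ≤ᵐ[μ] fun _ =>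
        D ^ 2 * η ^ 2 * (d : ℝ) ^ 2 * (L : ℝ) ^ 2 / δ ^ 2 + 23 * d * (L : ℝ) ^ 2) ∧
    (∀ t ≤ T,
      μ[fun ω => ‖gb t ω‖ ^ 2 | MeasurableSpace.comap (xb t) inferInstance] ≤ᵐ[μ] fun _ =>
        D ^ 2 * η ^ 2 * (d : ℝ) ^ 2 * (L : ℝ) ^ 2 / δ ^ 2 + 23 * d * (L : ℝ) ^ 2) ∧
    (η = R / (L * √(d * T)) → δ = R * √(d / T) →
      (∀ K : ℝ, D ≤ K * (L / √d) → D < L / √10 → ∀ t ≤ T,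
        μ[fun ω => ‖ga t ω‖ ^ 2 | ℱ t] ≤ᵐ[μ] fun _ =>
          (23 + 10 * K ^ 2) * d * (L : ℝ) ^ 2) ∧
      (∀ K : ℝ, D ≤ K * (√d * L) → ∀ t ≤ T,
        μ[fun ω => ‖gb t ω‖ ^ 2 | ℱ t] ≤ᵐ[μ] fun _ =>
          (23 + K ^ 2) * d * (L : ℝ) ^ 2)) := by
  have hmeas_a := ha.measurable_iterate_estimate isMeasurableVariation_temporalVariationA
  have hmeas_b := hb.measurable_iterate_estimate (isMeasurableVariation_temporalVariationB η L)
  have hint_a := ha.integrable_sq_norm_estimate_temporalVariationA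
  have hbound_a (t : ℕ) (ht : t + 1 ≤ T) :=
    ha.condExp_sq_norm_estimate_succ_le_temporalVariationA ht
  have hbound_b (t : ℕ) (ht : t ≤ T) :=
    hb.integrable_and_condExp_sq_norm_estimate_le_temporalVariationB ht
  refine ⟨fun t ht => ⟨(hmeas_a t ht).1, hint_a t ht, (hmeas_b t ht).1, (hbound_b t ht).1⟩,
    hbound_a, fun t ht => ?_, fun t ht => (hbound_b t ht).2, fun t ht => ?_, fun hη hδ => ?_⟩
  · exact condExp_ae_le_affine_of_le (hmeas_a _ ht).1.comap_le (ℱ.le _) (hint_a t (by lia))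
      (hbound_a t ht)
  · exact condExp_ae_le_const_of_le (hmeas_b t ht).1.comap_le (ℱ.le t) (hbound_b t ht).2
  · have hratio : η / δ * (d * L) = 1 :=
      stepSize_div_smoothingRadius d.cast_nonneg ha.eta_pos ha.delta_pos hη hδ
    exact ⟨fun K hK hDL t ht =>
        ha.condExp_sq_norm_estimate_le_of_threshold_temporalVariationA hratio hK hDL.le ht,
      fun K hK t ht =>
        hb.condExp_sq_norm_estimate_le_of_threshold_temporalVariationB hratio hK ht⟩

theorem lemma4 :
    ∃ c : ℝ, 0 < c ∧
      ∀ (d T : ℕ)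
        -- the probability space and the information `ℱ t` available before `u t` is drawn
        (Ω : Type*) (mΩ : MeasurableSpace Ω) (μ : Measure Ω) (_ : IsProbabilityMeasure μ)
        (ℱ : Filtration ℕ mΩ)
        -- the random directions, uniform on the sphere and independent of the past
        (u : ℕ → Ω → Metric.sphere (0 : EuclideanSpace ℝ (Fin d)) 1)
        (_ : ∀ t ≤ T, Measurable[ℱ (t + 1)] (u t))
        (_ : ∀ t ≤ T, μ.map (u t) = uniformSphere d)
        (_ : ∀ t ≤ T, Indep (MeasurableSpace.comap (u t) inferInstance) (ℱ t) μ)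
        -- the bounded feasible set, the starting point and the parameters
        (X : Set (EuclideanSpace ℝ (Fin d))) (_ : Convex ℝ X) (_ : IsClosed X)
        (R : ℝ) (_ : X ⊆ Metric.closedBall 0 R)
        (x₀ : EuclideanSpace ℝ (Fin d)) (_ : x₀ ∈ X)
        (η δ D : ℝ) (_ : 0 < η) (_ : 0 < δ) (_ : 0 < D)
        -- the losses, chosen by nature from the past, convex and Lipschitz
        (f : ℕ → Ω → EuclideanSpace ℝ (Fin d) → ℝ)
        (_ : ∀ t ≤ T, ∀ x ∈ Metric.cthickening δ X, Measurable[ℱ t] (fun ω => f t ω x))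
        (_ : ∀ t ≤ T, ∀ ω, ConvexOn ℝ X (f t ω))
        (Lt : ℕ → ℝ≥0)
        (_ : ∀ t ≤ T, ∀ ω, LipschitzOnWith (Lt t) (f t ω) (Metric.cthickening δ X))
        (L : ℝ≥0) (_ : L = (Finset.range (T + 1)).sup Lt)
        -- the iterates and the gradient estimates of the two methods
        (xa ga xb gb : ℕ → Ω → EuclideanSpace ℝ (Fin d))
        (_ : ∀ t ω, (xa t ω, ga t ω) =
          lazoRun temporalVariationA X x₀ η δ D (fun s => f s ω) (fun s => (u s ω).1) t)
        (_ : ∀ t ω, (xb t ω, gb t ω) =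
          lazoRun (temporalVariationB η L) X x₀ η δ D (fun s => f s ω) (fun s => (u s ω).1) t),
        -- the conditional expectations below are those of integrable functions, and the
        -- iterates are determined by the past
        (∀ t ≤ T, Measurable[ℱ t] (xa t) ∧ Integrable (fun ω => ‖ga t ω‖ ^ 2) μ ∧
          Measurable[ℱ t] (xb t) ∧ Integrable (fun ω => ‖gb t ω‖ ^ 2) μ) ∧
        -- first method, given the past
        (∀ t, t + 1 ≤ T →
          μ[fun ω => ‖ga (t + 1) ω‖ ^ 2 | ℱ (t + 1)] ≤ᵐ[μ] fun ω =>
            c * d * (L : ℝ) ^ 2 + 2 * (d : ℝ) ^ 2 * D ^ 2 * η ^ 2 / δ ^ 2 * ‖ga t ω‖ ^ 2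
              + 8 * (d : ℝ) ^ 2 * D ^ 2) ∧
        -- first method, given only the iterate
        (∀ t, t + 1 ≤ T →
          μ[fun ω => ‖ga (t + 1) ω‖ ^ 2 | MeasurableSpace.comap (xa (t + 1)) inferInstance]
            ≤ᵐ[μ] fun ω =>
            c * d * (L : ℝ) ^ 2 + 2 * (d : ℝ) ^ 2 * D ^ 2 * η ^ 2 / δ ^ 2 *
                (μ[fun ω' => ‖ga t ω'‖ ^ 2 |
                  MeasurableSpace.comap (xa (t + 1)) inferInstance]) ω
              + 8 * (d : ℝ) ^ 2 * D ^ 2) ∧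
        -- second method, given the past and given only the iterate
        (∀ t ≤ T,
          μ[fun ω => ‖gb t ω‖ ^ 2 | ℱ t] ≤ᵐ[μ] fun _ =>
            D ^ 2 * η ^ 2 * (d : ℝ) ^ 2 * (L : ℝ) ^ 2 / δ ^ 2 + c * d * (L : ℝ) ^ 2) ∧
        (∀ t ≤ T,
          μ[fun ω => ‖gb t ω‖ ^ 2 | MeasurableSpace.comap (xb t) inferInstance] ≤ᵐ[μ] fun _ =>
            D ^ 2 * η ^ 2 * (d : ℝ) ^ 2 * (L : ℝ) ^ 2 / δ ^ 2 + c * d * (L : ℝ) ^ 2) ∧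
        -- both bounds are of order `d` for the chosen step size, smoothing radius and threshold
        (η = R / (L * √(d * T)) → δ = R * √(d / T) →
          (∀ K : ℝ, D ≤ K * (L / √d) → D < L / √10 → ∀ t ≤ T,
            μ[fun ω => ‖ga t ω‖ ^ 2 | ℱ t] ≤ᵐ[μ] fun _ =>
              (c + 10 * K ^ 2) * d * (L : ℝ) ^ 2) ∧
          (∀ K : ℝ, D ≤ K * (√d * L) → ∀ t ≤ T,
            μ[fun ω => ‖gb t ω‖ ^ 2 | ℱ t] ≤ᵐ[μ] fun _ =>
              (c + K ^ 2) * d * (L : ℝ) ^ 2)) := by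
  refine ⟨23, by norm_num, ?_⟩
  intro d T Ω mΩ μ _ ℱ u hu hlaw hindep X hconvex hclosed R _ x₀ hx₀ η δ D hη hδ hD f hf _ Lt hLt
    L hL xa ga xb gb ha hb
  have hlip (t : ℕ) (ht : t ≤ T) (ω : Ω) : LipschitzOnWith L (f t ω) (Metric.cthickening δ X) :=
    (hLt t ht ω).weaken (hL ▸ Finset.le_sup (Finset.mem_range.2 (by lia)))
  exact lemma4_general
    ⟨hu, hlaw, hindep, hconvex, hclosed, hx₀, hη, hδ, hD.le, hf, hlip, fun ω t => ha t ω⟩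
    ⟨hu, hlaw, hindep, hconvex, hclosed, hx₀, hη, hδ, hD.le, hf, hlip, fun ω t => hb t ω⟩ R
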